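/- **Setting.** Let $L>0$, $T_0>0$, $\sigma>0$, let $U\subset\mathbb R$ be compact, and let $\mathcal P(S)$ be the set of Borel probability measures on $S$. For a separable bounded metric space $(S,d)$ put $W_1(\mu,\mu')=\inf_\pi\int d(x,y)\,d\pi(x,y)$, the infimum over all $\pi\in\mathcal P(S\times S)$ with marginals $\mu,\mu'$. For $T>0$ let $\mathcal P_{T,L}=\mathcal P(C([0,T]:[0,L]))$, where $C([0,T]:[0,L])$ has the uniform metric; for $\nu\in\mathcal P_{T,L}$ let $\nu(t)$ be its marginal at time $t$. Let $$b,f:[0,T_0]\times\mathcal P([0,L])\times[0,L]\times U\to\mathbb R,\quad g:\mathcal P([0,L])\times[0,L]\to\mathbb R,\quad y,r:[0,T_0]\to\mathbb R .$$ Assume: 1. There is $c_L\in(0,\infty)$ such that for all $t,t'\in[0,T_0]$, $\eta,\eta'\in\mathcal P([0,L])$, $x,x'\in[0,L]$, $u,u'\in U$, $$|f(t,\eta,x,u)-f(t',\eta',x',u')|+|g(\eta,x)-g(\eta',x')|+|b(t,\eta,x,u)-b(t',\eta',x',u')|+|y(t)-y(t')|+|r(t)-r(t')|$$ $$\le c_L\big(|t-t'|+W_1(\eta,\eta')+|x-x'|+|u-u'|\big).$$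 2. For all $(t,\eta,x,p)\in[0,T_0]\times\mathcal P([0,L])\times[0,L]\times\mathbb R$ the function $u\mapsto f(t,\eta,x,u)+b(t,\eta,x,u)p$ has a unique minimizer $\hat\alpha(t,\eta,x,p)$ in $U$. 3. There is $c_\alpha\in(0,\infty)$ such that for all $t\in[0,T_0]$, $\eta,\eta'\in\mathcal P([0,L])$, $x,x'\in[0,L]$, $p,p'\in\mathbb R$, $$|\hat\alpha(t,\eta,x,p)-\hat\alpha(t,\eta',x',p')|\le c_\alpha\big(W_1(\eta,\eta')+|x-x'|+|p-p'|\big).$$ Let $c_B=\sup|b|<\infty$. **The chain.** Let $0<T\le T_0$ and let $h>0$ with $hc_B\leq\sigma^2$ be such that $L/h$ and $N=T/\Delta$ are integers, where $\Delta=h^2/\sigma^2$. Put $t_j=j\Delta$. Fix $\nu\in\mathcal P_{T,L}$. The controlled chain lives on $\{-h,0,h,\dots,L,L+h\}$. At a time $t_j$, $j<N$, from a point $x\in\{0,h,\dots,L\}$, a control $u\in U$ is chosen as a function of the past and present positions of the chain, and the chain moves to $x\pm h$ with probability $\frac{\pm h\,b(t_j,\nu(t_j),x,u)+\sigma^2}{2\sigma^2}$;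 this takes time $\Delta$. If the new point is $-h$ or $L+h$, the chain then moves instantaneously, at the same time $t_{j+1}$, to $0$ or to $L$, respectively. Let $X(t_j)\in\{0,h,\dots,L\}$ be the position at time $t_j$ after such a reflection and $\alpha(t_j)$ the control used at time $t_j$. For $0\le i\le N$ and $x\in\{0,h,\dots,L\}$ let $$V^h_\nu(t_i,x)=\inf_\alpha\mathbb E\Big[\sum_{j=i}^{N-1}\Delta f(t_j,\nu(t_j),X(t_j),\alpha(t_j))+\sum_{j=i+1}^{N}h\big(y(t_j)1_{A_j}+r(t_j)1_{B_j}\big)+g(\nu(T),X(T))\Big],$$ where the chain starts at time $t_i$ in $x$, $A_j$ and $B_j$ are the events that at time $t_j$ it is reflected from $-h$ and from $L+h$, respectively, and the infimum is over all such controls $\alpha$. Put $V^h_\nu(t_j,-h)=y(t_j)h+V^h_\nu(t_j,0)$, $V^h_\nu(t_j,L+h)=r(t_j)h+V^h_\nu(t_j,L)$ and $$\mathcal D^hV^h_\nu(t_j,x)=\frac{V^h_\nu(t_{j+1},x+h)-V^h_\nu(t_{j+1},x-h)}{2h},\qquad 0\le j<N,\ x\in\{0,h,\dots,L\}.$$ For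 $x_0\in[0,L]$ let $\Phi^h(\nu)\in\mathcal P_{T,L}$ be the law of the path that is linear on every $[t_j,t_{j+1}]$ and equals $X(t_j)$ at $t_j$, $0\le j\le N$, where the chain starts at time $0$ in $\lfloor x_0/h\rfloor h$ and is controlled by the optimal feedback $\alpha(t_j)=\hat\alpha\big(t_j,\nu(t_j),X(t_j),\mathcal D^hV^h_\nu(t_j,X(t_j))\big)$. **Proposition.** Under assumptions 1–3 there exist $\hat T\in(0,T_0]$, $\hat h>0$ with $\hat h\,c_B\le\sigma^2$, and $q\in(0,1)$ such that for every $T\in(0,\hat T]$, every $x_0\in[0,L]$, every $h\in(0,\hat h\wedge\hat T)$ for which $L/h$ and $T\sigma^2/h^2$ are integers, and all $\nu,\nu'\in\mathcal P_{T,L}$, $$W_1^2\big(\Phi^h(\nu),\Phi^h(\nu')\big)\le q\big(h^2+W_1^2(\nu,\nu')\big).$$ -/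

import Mathlib

open MeasureTheory Set

noncomputable section

namespace ReflectedMFG

/-- The path space `C([0,T] : [0,L])`, with the uniform metric. -/
abbrev PathSpace (T L : ℝ) : Type := C(Icc (0 : ℝ) T, Icc (0 : ℝ) L)

/-- The path space carries its Borel σ-algebra. -/
instance instMeasurableSpacePathSpace (T L : ℝ) : MeasurableSpace (PathSpace T L) :=
  borel (PathSpace T L)

instance instBorelSpacePathSpace (T L : ℝ) : BorelSpace (PathSpace T L) := ⟨rfl⟩

/-- The Wasserstein distance of order one: the infimum of `∫ d(x,y) dπ(x,y)` over all couplings `π`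
of `μ` and `ν`. It is only used on separable bounded metric spaces with their Borel σ-algebra
(`[0,L]` and `C([0,T] : [0,L])`), where the integrand is always integrable. -/
def W₁ {S : Type*} [MeasurableSpace S] [MetricSpace S] (μ ν : ProbabilityMeasure S) : ℝ :=
  sInf {c : ℝ | ∃ π : ProbabilityMeasure (S × S),
    π.map measurable_fst.aemeasurable = μ ∧ π.map measurable_snd.aemeasurable = ν ∧
      c = ∫ z, dist z.1 z.2 ∂(π : Measure (S × S))}

/-- The law on `[0,L]` of the coordinate at time `t` under a law `ν` on path space.
(A time `t` outside `[0,T]` is moved to the nearest end point; only `t ∈ [0,T]` is used.) -/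
def marginal {T L : ℝ} (hT : 0 ≤ T) (ν : ProbabilityMeasure (PathSpace T L)) (t : ℝ) :
    ProbabilityMeasure (Icc (0 : ℝ) L) :=
  ν.map (f := fun w : PathSpace T L => w (projIcc 0 T hT t))
    (continuous_eval_const (F := PathSpace T L) (projIcc 0 T hT t)).measurable.aemeasurable

/-- The data of the control problem: control set `U`, diffusion coefficient `σ`, drift `b`, running
cost `f`, terminal cost `g`, and the costs `y`, `r` of reflection at `0` and at `L` (which do not
depend on the measure). The arguments of `b` and `f` are `(t, η, x, u)`. -/
structure Data (L : ℝ) where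
  U : Set ℝ
  σ : ℝ
  b : ℝ → ProbabilityMeasure (Icc (0 : ℝ) L) → ℝ → ℝ → ℝ
  f : ℝ → ProbabilityMeasure (Icc (0 : ℝ) L) → ℝ → ℝ → ℝ
  g : ProbabilityMeasure (Icc (0 : ℝ) L) → ℝ → ℝ
  y : ℝ → ℝ
  r : ℝ → ℝ

/-- The data are Lipschitz on `[0,T₀] × P([0,L]) × [0,L] × U`. -/
def Data.IsLipschitz {L : ℝ} (D : Data L) (T₀ : ℝ) : Prop :=
  ∃ c : ℝ, 0 < c ∧ ∀ t ∈ Icc 0 T₀, ∀ t' ∈ Icc 0 T₀, ∀ η η' : ProbabilityMeasure (Icc (0 : ℝ) L),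
    ∀ x ∈ Icc 0 L, ∀ x' ∈ Icc 0 L, ∀ u ∈ D.U, ∀ u' ∈ D.U,
      |D.f t η x u - D.f t' η' x' u'| + |D.g η x - D.g η' x'| + |D.b t η x u - D.b t' η' x' u'|
          + |D.y t - D.y t'| + |D.r t - D.r t'|
        ≤ c * (|t - t'| + W₁ η η' + |x - x'| + |u - u'|)

/-- `αhat t η x p` is the unique minimizer over `U` of `u ↦ f(t,η,x,u) + b(t,η,x,u) p`. -/
def Data.IsUniqueMinimizer {L : ℝ} (D : Data L) (T₀ : ℝ)
    (αhat : ℝ → ProbabilityMeasure (Icc (0 : ℝ) L) → ℝ → ℝ → ℝ) : Prop :=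
  ∀ t ∈ Icc 0 T₀, ∀ η : ProbabilityMeasure (Icc (0 : ℝ) L), ∀ x ∈ Icc 0 L, ∀ p : ℝ,
    αhat t η x p ∈ D.U ∧ ∀ u ∈ D.U, u ≠ αhat t η x p →
      D.f t η x (αhat t η x p) + D.b t η x (αhat t η x p) * p < D.f t η x u + D.b t η x u * p

/-- `αhat` is Lipschitz in `(η, x, p)`, uniformly in time. -/
def IsLipschitzSelector {L : ℝ} (T₀ : ℝ)
    (αhat : ℝ → ProbabilityMeasure (Icc (0 : ℝ) L) → ℝ → ℝ → ℝ) : Prop :=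
  ∃ c : ℝ, 0 < c ∧ ∀ t ∈ Icc 0 T₀, ∀ η η' : ProbabilityMeasure (Icc (0 : ℝ) L),
    ∀ x ∈ Icc 0 L, ∀ x' ∈ Icc 0 L, ∀ p p' : ℝ,
      |αhat t η x p - αhat t η' x' p'| ≤ c * (W₁ η η' + |x - x'| + |p - p'|)

/-- A discretization: a space step `h` such that `L / h = K` and `T / Δ = N` are integers, where
`Δ = h² / σ²` is the time step. -/
structure Mesh (L T σ : ℝ) where
  h : ℝ
  h_pos : 0 < h
  K : ℕ
  N : ℕ
  K_mul_h : K * h = L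
  N_mul_Δ : N * (h ^ 2 / σ ^ 2) = T

namespace Mesh

variable {L T σ : ℝ} (G : Mesh L T σ)

/-- The time step `Δ = h² / σ²`. -/
def Δ : ℝ := G.h ^ 2 / σ ^ 2

/-- The grid time `t_j = j Δ`. -/
def time (j : ℕ) : ℝ := j * G.Δ

lemma T_nonneg {L T σ : ℝ} (G : Mesh L T σ) : 0 ≤ T := by
  rw [← G.N_mul_Δ]
  positivity

lemma L_nonneg {L T σ : ℝ} (G : Mesh L T σ) : 0 ≤ L := by
  rw [← G.K_mul_h]
  exact mul_nonneg (Nat.cast_nonneg _) G.h_pos.le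

/-- The position in `ℝ` of the `k`-th grid point. The grid `{-h, 0, h, …, L, L + h}` corresponds
to `k ∈ {-1, 0, …, K + 1}`. -/
def pos (k : ℤ) : ℝ := k * G.h

/-- The reflection step, which takes no time: `-h ↦ 0` and `L + h ↦ L`; all other points stay. -/
def reflect (k : ℤ) : ℤ := if k = -1 then 0 else if k = G.K + 1 then G.K else k

/-- The continuous path on `[0,T]` that is linear on every `[t_j, t_{j+1}]` and whose value at `t_j`
is the position of the grid point `X j`, for `j = 0, …, N`. It is written as the initial value plus
the successive increments, each of them run at constant speed during its own time step (so the
projection on `[0,L]` does nothing for a grid path in `{0, h, …, L}`). -/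
def interpolate (X : Fin (G.N + 1) → ℤ) : PathSpace T L where
  toFun t := projIcc 0 L G.L_nonneg
    (G.pos (X 0) + ∑ j : Fin G.N, (G.pos (X j.succ) - G.pos (X j.castSucc)) *
      max 0 (min 1 ((t : ℝ) / G.Δ - (j : ℕ))))
  continuous_toFun := by
    refine continuous_projIcc.comp ?_
    fun_prop

end Mesh

/-- The law on `{false, true}` giving probability `p` to `true`. -/
def coin (p : Icc (0 : ℝ) 1) : PMF Bool :=
  PMF.ofFintype (fun c => if c then ENNReal.ofReal p else ENNReal.ofReal (1 - p)) (by
    rw [Fintype.sum_bool]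
    simp only [if_true, Bool.false_eq_true, if_false]
    rw [← ENNReal.ofReal_add p.2.1 (sub_nonneg.2 p.2.2)]
    simp)

/-- The expectation of `c` under a law `P` with countable support. -/
def expect {Ω : Type*} (P : PMF Ω) (c : Ω → ℝ) : ℝ := ∑' ω, (P ω).toReal * c ω

/-- The history `(Z 0, …, Z l)` up to step `l` of a longer trajectory `(Z 0, …, Z m)`. -/
def history {m : ℕ} (Z : Fin (m + 1) → ℤ) (l : Fin m) : Fin ((l : ℕ) + 1) → ℤ :=
  fun a => Z (Fin.castLE (Nat.succ_le_succ l.isLt.le) a)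

/-- A real-valued policy chooses the control of the `m`-th rate control step as a function of the
whole history `(Z 0, …, Z m)` of the chain. -/
abbrev RawPolicy : Type := (m : ℕ) → (Fin (m + 1) → ℤ) → ℝ

/-- Admissible policies: all controls lie in `U`. -/
abbrev Policy (U : Set ℝ) : Type := {π : RawPolicy // ∀ m Z, π m Z ∈ U}

section Chain

variable {L T : ℝ} (D : Data L) (G : Mesh L T D.σ) (ν : ProbabilityMeasure (PathSpace T L))

/-- The marginal `ν(t_j)`. -/
def flow (j : ℕ) : ProbabilityMeasure (Icc (0 : ℝ) L) := marginal G.T_nonneg ν (G.time j)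

/-- The probability `(h b(t_j, ν(t_j), x, u) + σ²) / (2σ²)` of moving from `x` to `x + h` in a rate
control step. (The projection on `[0,1]` does nothing as soon as `h |b| ≤ σ²`.) -/
def upProb (j : ℕ) (k : ℤ) (u : ℝ) : Icc (0 : ℝ) 1 :=
  projIcc 0 1 zero_le_one
    ((G.h * D.b (G.time j) (flow D G ν j) (G.pos k) u + D.σ ^ 2) / (2 * D.σ ^ 2))

/-- The rate control step at time `t_j` from the grid point `k ∈ {0, …, K}` under the control `u`:
the chain moves to `k + 1` or to `k - 1`, that is, to a point of `{-1, …, K + 1}`. -/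
def rateStep (j : ℕ) (k : ℤ) (u : ℝ) : PMF ℤ :=
  (coin (upProb D G ν j k u)).map (fun up => if up then k + 1 else k - 1)

/-- The law of the controlled chain started at time `t_i` in the grid point `k`, over `m` time
steps. A trajectory `(Z 0, …, Z m)` lists the points of `{-1, …, K + 1}` where the chain is after
`0, …, m` rate control steps, before the reflection step that follows if `Z l ∈ {-1, K + 1}`. So
the position of the chain at time `t_{i+l}`, all steps at that time included, is `reflect (Z l)`,
and the next rate control step is made from there, under the control chosen from the history. -/
def chainLaw (π : RawPolicy) (i : ℕ) (k : ℤ) : (m : ℕ) → PMF (Fin (m + 1) → ℤ)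
  | 0 => PMF.pure (fun _ => k)
  | m + 1 => (chainLaw π i k m).bind fun Z =>
      (rateStep D G ν (i + m) (G.reflect (Z (Fin.last m))) (π m Z)).map
        (fun z => (Fin.snoc (α := fun _ => ℤ) Z z : Fin (m + 1 + 1) → ℤ))

/-- The cost, over the times from `t_i` to `t_{i+m}`, along a trajectory `Z`: the integral in time
of the (piecewise constant) running cost, the cost `y(t) h` for each reflection from `-h` at a time
`t`, the cost `r(t) h` for each reflection from `L + h` at a time `t`, and the terminal cost. -/
def pathCost (π : RawPolicy) (i m : ℕ) (Z : Fin (m + 1) → ℤ) : ℝ :=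
  (∑ l : Fin m,
    (G.Δ * D.f (G.time (i + l)) (flow D G ν (i + l)) (G.pos (G.reflect (Z l.castSucc)))
        (π l (history Z l))
      + (if Z l.succ = -1 then D.y (G.time (i + l + 1)) * G.h else 0)
      + (if Z l.succ = G.K + 1 then D.r (G.time (i + l + 1)) * G.h else 0)))
  + D.g (flow D G ν G.N) (G.pos (G.reflect (Z (Fin.last m))))

/-- The expected cost from time `t_i` to `T` of a policy, for the chain started at time `t_i` in the
grid point `k`. -/
def J (π : RawPolicy) (i : ℕ) (k : ℤ) : ℝ :=
  expect (chainLaw D G ν π i k (G.N - i)) (pathCost D G ν π i (G.N - i))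

/-- The value function at `(t_i, k h)`, `k ∈ {0, …, K}`: the infimum of the cost over all
admissible policies. -/
def V (i : ℕ) (k : ℤ) : ℝ := ⨅ π : Policy D.U, J D G ν π.1 i k

/-- The value function, extended to the two outer points `-h` and `L + h`. -/
def Vext (i : ℕ) (k : ℤ) : ℝ :=
  if k = -1 then D.y (G.time i) * G.h + V D G ν i 0
  else if k = G.K + 1 then D.r (G.time i) * G.h + V D G ν i G.K
  else V D G ν i k

/-- The central finite difference of the value function, taken at the next time step:
`(V(t_j + Δ, x + h) - V(t_j + Δ, x - h)) / (2h)` at `x = k h`. -/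
def gradV (j : ℕ) (k : ℤ) : ℝ :=
  (Vext D G ν (j + 1) (k + 1) - Vext D G ν (j + 1) (k - 1)) / (2 * G.h)

/-- The optimal feedback control, `αhat(t_j, ν(t_j), x, DV(t_j, x))` at the current position `x`. -/
def optimalPolicy (αhat : ℝ → ProbabilityMeasure (Icc (0 : ℝ) L) → ℝ → ℝ → ℝ) : RawPolicy :=
  fun j Z =>
    αhat (G.time j) (flow D G ν j) (G.pos (G.reflect (Z (Fin.last j))))
      (gradV D G ν j (G.reflect (Z (Fin.last j))))

/-- `Φ^h(ν)`: the law on `C([0,T] : [0,L])` of the linear interpolation of the optimally controlled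
reflected chain started at time `0` in `⌊x₀ / h⌋ h`. -/
def Φ (αhat : ℝ → ProbabilityMeasure (Icc (0 : ℝ) L) → ℝ → ℝ → ℝ) (x₀ : ℝ) :
    ProbabilityMeasure (PathSpace T L) :=
  ⟨((chainLaw D G ν (optimalPolicy D G ν αhat) 0 ⌊x₀ / G.h⌋ G.N).map
      (fun Z => G.interpolate (fun j => G.reflect (Z j)))).toMeasure, inferInstance⟩

end Chain

end ReflectedMFG

end

/-! The map is a contraction because the optimal feedback depends in a Lipschitz way on the flow of
measures and on the position. The Lipschitz constant blows up only like the inverse square root of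
the time to maturity. That singularity is integrable, so a Gronwall argument for a coupling of the
two chains gains a factor of order `√T`, uniformly in the mesh.

Dynamic programming (`V_eq_dpValue`, `V_recursion`) turns the value function into the solution of a
discrete Hamilton-Jacobi equation: its linear part averages over the two neighbours, and its source
is `Δ` times the minimized Hamiltonian at the central difference. The condition `G.h * cB ≤ D.σ ^ 2`
makes this scheme monotone, so a maximum principle bounds the gradient by `gradBound`, independently
of the mesh (`abs_Vext_succ_sub_le`). On bounded gradients the Hamiltonian is Lipschitz.

The gradient estimates rest on smoothing: after `n` steps of the simple random walk a bounded
function has central differences of order `1 / √(n + 1)` (`abs_heat_iterate_diff_le`). Duhamel's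
formula extends this to a source controlled by the gradient itself (`abs_diff_le_of_heat`).
Reflection is removed by folding `ℤ` onto the grid, under which functions without boundary slope
become solutions on all of `ℤ`. The difference of two value functions has no boundary slope, because
the reflection costs do not depend on the measure; this gives the dependence on the flow
(`abs_gradV_sub_measure_le`). For the dependence on the position a quadratic corrector first removes
the slopes, and smoothing is applied to forward differences (`abs_gradV_succ_sub_le`).

The two optimally controlled chains are then coupled so that each pair of steps disagrees with the
least possible probability. Twice the number of disagreements bounds the distance in grid units at
all times. Its expectation obeys a linear recursion with weights of size `Δ / (h √(N - j))`, which
sum to order `√T`. For small `T` this gives `W₁ (Φ ν) (Φ ν') ≤ W₁ ν ν' / 2` (`W₁_Φ_le`), which is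
stronger than the claim: the term `h²` is slack. -/

noncomputable section

namespace ReflectedMFG

/-! ### Smoothing by the simple random walk. -/

/-- One step of the simple random walk on `ℤ`, acting on functions. -/
def heat (φ : ℤ → ℝ) (x : ℤ) : ℝ := (φ (x + 1) + φ (x - 1)) / 2

lemma heat_mono {φ ψ : ℤ → ℝ} (h : ∀ x, φ x ≤ ψ x) (n : ℕ) :
    ∀ x, heat^[n] φ x ≤ heat^[n] ψ x := by
  induction n generalizing φ ψ with
  | zero => exact h
  | succ n ih =>
    intro x
    simp only [Function.iterate_succ, Function.comp]
    refine ih (fun z => ?_) x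
    have h1 := h (z + 1)
    have h2 := h (z - 1)
    simp only [heat]
    linarith

lemma heat_iterate_lin (φ ψ : ℤ → ℝ) (a b : ℝ) (n : ℕ) (x : ℤ) :
    heat^[n] (fun z => a * φ z + b * ψ z) x = a * heat^[n] φ x + b * heat^[n] ψ x := by
  induction n generalizing x with
  | zero => rfl
  | succ n ih =>
    simp only [Function.iterate_succ', Function.comp, heat, ih]
    ring

lemma heat_iterate_const (a : ℝ) (n : ℕ) (x : ℤ) : heat^[n] (fun _ => a) x = a := by
  induction n generalizing x with
  | zero => rfl
  | succ n ih =>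
    simp only [Function.iterate_succ', Function.comp, heat, ih]
    ring

/-- Each step adds variance one. This second moment is the only property of the walk's law that the
smoothing estimate needs besides the commutator. -/
lemma heat_iterate_sq (a : ℝ) (n : ℕ) (x : ℤ) :
    heat^[n] (fun z => ((z : ℝ) - a) ^ 2) x = (x - a) ^ 2 + n := by
  induction n generalizing x with
  | zero => simp
  | succ n ih =>
    simp only [Function.iterate_succ', Function.comp, heat, ih]
    push_cast
    ring

/-- The commutator of the random walk semigroup with multiplication by the coordinate. -/
lemma heat_iterate_commutator (φ : ℤ → ℝ) (n : ℕ) (x : ℤ) :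
    heat^[n + 1] (fun z => (z : ℝ) * φ z) x - x * heat^[n + 1] φ x
      = (n + 1) / 2 * (heat^[n] φ (x + 1) - heat^[n] φ (x - 1)) := by
  induction n generalizing x with
  | zero =>
    simp only [Function.iterate_succ', Function.comp, heat, Function.iterate_zero, id]
    push_cast
    ring
  | succ n ih =>
    have h1 := ih (x + 1)
    have h2 := ih (x - 1)
    have e1 : x + 1 - 1 = x := by ring
    have e2 : x - 1 + 1 = x := by ring
    rw [Function.iterate_succ' heat (n + 1)]
    simp only [Function.comp, heat]
    have h3 : heat^[n + 1] φ (x + 1) = (heat^[n] φ (x + 1 + 1) + heat^[n] φ x) / 2 := by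
      rw [Function.iterate_succ']
      simp only [Function.comp, heat, e1]
    have h4 : heat^[n + 1] φ (x - 1) = (heat^[n] φ x + heat^[n] φ (x - 1 - 1)) / 2 := by
      rw [Function.iterate_succ']
      simp only [Function.comp, heat, e2]
    rw [e1] at h1
    rw [e2] at h2
    push_cast at h1 h2 ⊢
    linear_combination (h1 + h2) / 2 - (n + 1) / 2 * (h3 - h4)

/-- Smoothing by the simple random walk. -/
lemma abs_heat_iterate_diff_le {φ : ℤ → ℝ} {M : ℝ} (hφ : ∀ x, |φ x| ≤ M) (n : ℕ) (x : ℤ) :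
    |heat^[n] φ (x + 1) - heat^[n] φ (x - 1)| ≤ 2 * M / √(n + 1) := by
  have hM : 0 ≤ M := (abs_nonneg _).trans (hφ 0)
  set s : ℝ := √(n + 1) with hs
  have hs0 : 0 < s := Real.sqrt_pos.2 (by positivity)
  have hs2 : s ^ 2 = n + 1 := Real.sq_sqrt (by positivity)
  -- Young's inequality with the weight `s` that balances the two terms: after `n + 1` steps the
  -- second moment is `s ^ 2`, so each contributes `M * s / 2`. This replaces Cauchy-Schwarz for the
  -- first moment.
  have key : ∀ z : ℤ, |((z : ℝ) - x) * φ z| ≤ M / (2 * s) * ((z : ℝ) - x) ^ 2 + M * s / 2 := by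
    intro z
    rw [abs_mul]
    have h1 : |(z : ℝ) - x| * |φ z| ≤ |(z : ℝ) - x| * M :=
      mul_le_mul_of_nonneg_left (hφ z) (abs_nonneg _)
    have h2 : M / (2 * s) * ((z : ℝ) - x) ^ 2 + M * s / 2 - |(z : ℝ) - x| * M
        = M / (2 * s) * (|(z : ℝ) - x| - s) ^ 2 := by
      rw [← sq_abs ((z : ℝ) - x)]
      field_simp
      ring
    have h3 : 0 ≤ M / (2 * s) * (|(z : ℝ) - x| - s) ^ 2 := by positivity
    linarith
  have hup : heat^[n + 1] (fun z => M / (2 * s) * ((z : ℝ) - x) ^ 2 + (M * s / 2) * 1) x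
      = M * s := by
    rw [heat_iterate_lin (fun z => ((z : ℝ) - x) ^ 2) (fun _ => 1), heat_iterate_sq,
      heat_iterate_const]
    push_cast
    rw [← hs2]
    field_simp
    ring
  have hT : heat^[n + 1] (fun z => ((z : ℝ) - x) * φ z) x
      = (n + 1) / 2 * (heat^[n] φ (x + 1) - heat^[n] φ (x - 1)) := by
    rw [← heat_iterate_commutator]
    have := heat_iterate_lin (fun z => (z : ℝ) * φ z) φ 1 (-(x : ℝ)) (n + 1) x
    rw [show (fun z : ℤ => ((z : ℝ) - x) * φ z) = fun z : ℤ => 1 * ((z : ℝ) * φ z) + -(x : ℝ) * φ z by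
      funext z; ring, this]
    ring
  have h1 : heat^[n + 1] (fun z => ((z : ℝ) - x) * φ z) x ≤ M * s := by
    rw [← hup]
    refine heat_mono (fun z => ?_) _ _
    rw [mul_one]
    exact (le_abs_self _).trans (key z)
  have h2 : -(M * s) ≤ heat^[n + 1] (fun z => ((z : ℝ) - x) * φ z) x := by
    rw [← hup]
    have := heat_iterate_lin (fun z => M / (2 * s) * ((z : ℝ) - x) ^ 2 + (M * s / 2) * 1)
      (fun _ => 0) (-1) 0 (n + 1) x
    rw [← sub_nonneg]
    have h := heat_mono (φ := fun z : ℤ => -1 * (M / (2 * s) * ((z : ℝ) - x) ^ 2 + (M * s / 2) * 1)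
      + 0 * 0) (ψ := fun z : ℤ => ((z : ℝ) - x) * φ z) (fun z => by
        have := neg_le_of_abs_le (key z)
        linarith) (n + 1) x
    linarith
  rw [hT] at h1 h2
  rw [le_div_iff₀ hs0]
  have h3 : (n + 1 : ℝ) / 2 * |heat^[n] φ (x + 1) - heat^[n] φ (x - 1)| ≤ M * s := by
    rw [← abs_of_nonneg (show (0 : ℝ) ≤ (n + 1) / 2 by positivity), ← abs_mul]
    exact abs_le.2 ⟨h2, h1⟩
  rw [← hs2] at h3
  refine le_of_mul_le_mul_left ?_ (half_pos hs0)
  linarith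

/-- Duhamel's formula for the discrete heat equation. -/
lemma heat_duhamel {u F : ℕ → ℤ → ℝ} {N : ℕ}
    (hu : ∀ n < N, ∀ x, u (n + 1) x = heat (u n) x + F n x) :
    ∀ n ≤ N, ∀ x, u n x
      = heat^[n] (u 0) x + ∑ i ∈ Finset.range n, heat^[n - 1 - i] (F i) x := by
  intro n
  induction n with
  | zero => simp
  | succ n ih =>
    intro hn x
    rw [hu n hn, heat, ih (by omega), ih (by omega), Finset.sum_range_succ,
      Function.iterate_succ']
    have : ∑ i ∈ Finset.range n, heat^[n + 1 - 1 - i] (F i) x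
        = ∑ i ∈ Finset.range n,
          (heat^[n - 1 - i] (F i) (x + 1) + heat^[n - 1 - i] (F i) (x - 1)) / 2 := by
      refine Finset.sum_congr rfl fun i hi => ?_
      rw [Finset.mem_range] at hi
      rw [show n + 1 - 1 - i = (n - 1 - i) + 1 by omega, Function.iterate_succ']
      rfl
    rw [this, ← Finset.sum_div, Finset.sum_add_distrib]
    simp [heat]
    ring

/-! ### Square-root singular sums and the gradient estimate for a semilinear source. -/

lemma sum_inv_sqrt_le (n : ℕ) : ∑ i ∈ Finset.range n, 1 / √((i : ℝ) + 1) ≤ 2 * √n := by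
  induction n with
  | zero => simp
  | succ n ih =>
    rw [Finset.sum_range_succ]
    push_cast
    have ha : (0 : ℝ) < √((n : ℝ) + 1) := Real.sqrt_pos.2 (by positivity)
    have ha2 : √((n : ℝ) + 1) ^ 2 = n + 1 := Real.sq_sqrt (by positivity)
    have hb2 : √(n : ℝ) ^ 2 = n := Real.sq_sqrt (by positivity)
    have : 1 / √((n : ℝ) + 1) ≤ 2 * (√((n : ℝ) + 1) - √n) := by
      rw [div_le_iff₀ ha]
      nlinarith [sq_nonneg (√((n : ℝ) + 1) - √n)]
    linarith

lemma sum_inv_sqrt_sub_le (n : ℕ) : ∑ i ∈ Finset.range n, 1 / √((n : ℝ) - i) ≤ 2 * √n := by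
  rw [← Finset.sum_range_reflect]
  refine le_trans (le_of_eq (Finset.sum_congr rfl fun i hi => ?_)) (sum_inv_sqrt_le n)
  rw [Finset.mem_range] at hi
  congr 2
  rw [Nat.sub_sub, Nat.cast_sub (by omega)]
  push_cast
  ring

/-- A discrete form of the Beta integral `∫ (t - s)^(-1/2) s^(-1/2) ds`, which does not depend on
`t`. Since `s ≤ √(n - i) + √(i + 1)`, the product of the two singular factors is at most `1 / s`
times their sum, and each of them sums to at most `2 * s`. -/
lemma sum_inv_sqrt_mul_le (n : ℕ) :
    ∑ i ∈ Finset.range n, 1 / √((n : ℝ) - i) * (1 / √((i : ℝ) + 1)) ≤ 4 := by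
  set s : ℝ := √((n : ℝ) + 1)
  have hs0 : 0 < s := Real.sqrt_pos.2 (by positivity)
  have h : ∀ i ∈ Finset.range n, 1 / √((n : ℝ) - i) * (1 / √((i : ℝ) + 1))
      ≤ 1 / s * (1 / √((n : ℝ) - i) + 1 / √((i : ℝ) + 1)) := by
    intro i hi
    rw [Finset.mem_range] at hi
    have hni : (0 : ℝ) < n - i := sub_pos.2 (by exact_mod_cast hi)
    have ha : 0 < √((n : ℝ) - i) := Real.sqrt_pos.2 hni
    have hb : 0 < √((i : ℝ) + 1) := Real.sqrt_pos.2 (by positivity)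
    have ha2 : √((n : ℝ) - i) ^ 2 = n - i := Real.sq_sqrt hni.le
    have hb2 : √((i : ℝ) + 1) ^ 2 = i + 1 := Real.sq_sqrt (by positivity)
    have hs : s ≤ √((n : ℝ) - i) + √((i : ℝ) + 1) := by
      refine Real.sqrt_le_iff.2 ⟨by positivity, ?_⟩
      nlinarith [mul_pos ha hb]
    rw [← sub_nonneg]
    have : 1 / s * (1 / √((n : ℝ) - i) + 1 / √((i : ℝ) + 1))
        - 1 / √((n : ℝ) - i) * (1 / √((i : ℝ) + 1))
        = (√((n : ℝ) - i) + √((i : ℝ) + 1) - s) / (s * √((n : ℝ) - i) * √((i : ℝ) + 1)) := by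
      field_simp
      ring
    rw [this]
    exact div_nonneg (sub_nonneg.2 hs) (by positivity)
  refine (Finset.sum_le_sum h).trans ?_
  rw [← Finset.mul_sum, Finset.sum_add_distrib, one_div, inv_mul_le_iff₀ hs0]
  have h1 := sum_inv_sqrt_le n
  have h2 := sum_inv_sqrt_sub_le n
  have h3 : √(n : ℝ) ≤ s := Real.sqrt_le_sqrt (by linarith)
  linarith

/-- Gradient bound for a discrete heat equation whose source is controlled by the gradient. -/
lemma abs_diff_le_of_heat {u F : ℕ → ℤ → ℝ} {N : ℕ} {M β e : ℝ}
    (hu : ∀ n < N, ∀ x, u (n + 1) x = heat (u n) x + F n x)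
    (hM : ∀ x, |u 0 x| ≤ M) (hβ : 0 ≤ β) (he : 0 ≤ e)
    (hF : ∀ n < N, ∀ d, (∀ x, |u n (x + 1) - u n (x - 1)| ≤ d) → ∀ x, |F n x| ≤ β * d + e)
    (hN : 16 * β * √(N + 1) ≤ 1) :
    ∀ n ≤ N, ∀ x, |u n (x + 1) - u n (x - 1)| ≤ (4 * M + 8 * e * (N + 1)) / √(n + 1) := by
  intro n
  induction n using Nat.strong_induction_on with
  | _ n ih =>
  intro hn x
  have hM0 : 0 ≤ M := (abs_nonneg _).trans (hM 0)
  -- Twice the contribution of the initial value and of `e`: the feedback of the gradient through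
  -- `β` costs at most `m / 2` by `hN`, so the induction closes with the same `m`.
  set m : ℝ := 4 * M + 8 * e * (N + 1) with hm
  have hm0 : 0 ≤ m := by positivity
  set s : ℝ := √((n : ℝ) + 1)
  have hs0 : 0 < s := Real.sqrt_pos.2 (by positivity)
  have hsN : s ≤ √((N : ℝ) + 1) := Real.sqrt_le_sqrt (by
    have : (n : ℝ) ≤ N := by exact_mod_cast hn
    linarith)
  have hs2 : s ^ 2 = n + 1 := Real.sq_sqrt (by positivity)
  have hterm : ∀ i ∈ Finset.range n,
      |heat^[n - 1 - i] (F i) (x + 1) - heat^[n - 1 - i] (F i) (x - 1)|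
        ≤ 2 * β * m * (1 / √((n : ℝ) - i) * (1 / √((i : ℝ) + 1)))
          + 2 * e * (1 / √((n : ℝ) - i)) := by
    intro i hi
    rw [Finset.mem_range] at hi
    have h1 := abs_heat_iterate_diff_le (hF i (by omega) _ (ih i hi (by omega))) (n - 1 - i) x
    have h2 : ((n - 1 - i : ℕ) : ℝ) + 1 = n - i := by
      rw [Nat.sub_sub, Nat.cast_sub (by omega)]
      push_cast
      ring
    rw [h2] at h1
    refine h1.trans (le_of_eq ?_)
    ring
  have hD : |u n (x + 1) - u n (x - 1)| ≤ 2 * M / s + (2 * β * m * 4 + 2 * e * (2 * s)) := by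
    rw [heat_duhamel hu n hn, heat_duhamel hu n hn, add_sub_add_comm, ← Finset.sum_sub_distrib]
    refine (abs_add_le _ _).trans (add_le_add (abs_heat_iterate_diff_le hM n x) ?_)
    refine (Finset.abs_sum_le_sum_abs _ _).trans ((Finset.sum_le_sum hterm).trans ?_)
    rw [Finset.sum_add_distrib, ← Finset.mul_sum, ← Finset.mul_sum]
    have h3 : √(n : ℝ) ≤ s := Real.sqrt_le_sqrt (by linarith)
    have h4 := sum_inv_sqrt_sub_le n
    exact add_le_add (mul_le_mul_of_nonneg_left (sum_inv_sqrt_mul_le n) (by positivity))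
      (mul_le_mul_of_nonneg_left (by linarith) (by positivity))
  refine hD.trans ?_
  rw [le_div_iff₀ hs0]
  have e1 : (2 * M / s + (2 * β * m * 4 + 2 * e * (2 * s))) * s
      = 2 * M + 8 * β * m * s + 4 * e * (n + 1) := by
    rw [← hs2]
    field_simp
    ring
  rw [e1]
  have h5 : 8 * β * m * s ≤ m / 2 := by
    have : 16 * β * s ≤ 1 := (mul_le_mul_of_nonneg_left hsN (by positivity)).trans hN
    nlinarith
  have h6 : e * (n + 1) ≤ e * (N + 1) :=
    mul_le_mul_of_nonneg_left (by
      have : (n : ℝ) ≤ N := by exact_mod_cast hn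
      linarith) he
  linarith

/-! ### The Wasserstein distance on bounded spaces. -/

section Wasserstein

variable {S : Type*} [MeasurableSpace S] [MetricSpace S]

/-- The costs of the couplings of two laws. -/
def couplingCosts (μ ν : ProbabilityMeasure S) : Set ℝ :=
  {c : ℝ | ∃ π : ProbabilityMeasure (S × S),
    π.map measurable_fst.aemeasurable = μ ∧ π.map measurable_snd.aemeasurable = ν ∧
      c = ∫ z, dist z.1 z.2 ∂(π : Measure (S × S))}

lemma bddBelow_couplingCosts (μ ν : ProbabilityMeasure S) : BddBelow (couplingCosts μ ν) :=
  ⟨0, by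
    rintro c ⟨π, -, -, rfl⟩
    exact integral_nonneg fun _ => dist_nonneg⟩

lemma couplingCosts_nonempty (μ ν : ProbabilityMeasure S) : (couplingCosts μ ν).Nonempty :=
  ⟨_, μ.prod ν, by simp, by simp, rfl⟩

lemma W₁_nonneg (μ ν : ProbabilityMeasure S) : 0 ≤ W₁ μ ν :=
  Real.sInf_nonneg (by
    rintro c ⟨π, -, -, rfl⟩
    exact integral_nonneg fun _ => dist_nonneg)

lemma W₁_le_integral (π : ProbabilityMeasure (S × S)) {μ ν : ProbabilityMeasure S}
    (h1 : π.map measurable_fst.aemeasurable = μ) (h2 : π.map measurable_snd.aemeasurable = ν) :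
    W₁ μ ν ≤ ∫ z, dist z.1 z.2 ∂(π : Measure (S × S)) :=
  csInf_le (bddBelow_couplingCosts μ ν) ⟨π, h1, h2, rfl⟩

lemma W₁_le_of_dist_le {C : ℝ} (hC : ∀ x y : S, dist x y ≤ C) (μ ν : ProbabilityMeasure S) :
    W₁ μ ν ≤ C := by
  obtain ⟨c, hc⟩ := couplingCosts_nonempty μ ν
  obtain ⟨π, h1, h2, -⟩ := hc
  refine (W₁_le_integral π h1 h2).trans ?_
  have h := norm_integral_le_of_norm_le_const (μ := (π : Measure (S × S)))
    (f := fun z => dist z.1 z.2) (C := C)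
    (Filter.Eventually.of_forall fun z => by
      rw [Real.norm_of_nonneg dist_nonneg]; exact hC _ _)
  refine (le_abs_self _).trans (h.trans (le_of_eq ?_))
  simp

lemma integrable_dist_of_le [OpensMeasurableSpace S] [SecondCountableTopology S] {C : ℝ}
    (hC : ∀ x y : S, dist x y ≤ C) (π : ProbabilityMeasure (S × S)) :
    Integrable (fun z : S × S => dist z.1 z.2) (π : Measure (S × S)) :=
  Integrable.of_bound (C := C) (measurable_fst.dist measurable_snd).aestronglyMeasurable
    (Filter.Eventually.of_forall fun z => by
      rw [Real.norm_of_nonneg dist_nonneg]; exact hC _ _)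

lemma W₁_self [OpensMeasurableSpace S] [SecondCountableTopology S] (μ : ProbabilityMeasure S) :
    W₁ μ μ = 0 := by
  have hd : Measurable fun x : S => (x, x) := measurable_id.prodMk measurable_id
  refine le_antisymm ?_ (W₁_nonneg μ μ)
  refine (W₁_le_integral (μ.map hd.aemeasurable) ?_ ?_).trans (le_of_eq ?_)
  · ext s hs
    simp [Measure.map_map measurable_fst hd, Function.comp_def]
  · ext s hs
    simp [Measure.map_map measurable_snd hd, Function.comp_def]
  · rw [ProbabilityMeasure.toMeasure_map, integral_map hd.aemeasurable
      (measurable_fst.dist measurable_snd).aestronglyMeasurable]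
    simp

/-- Images under a nonexpansive map are not further apart. -/
lemma W₁_map_le {S' : Type*} [MeasurableSpace S'] [MetricSpace S']
    [OpensMeasurableSpace S] [SecondCountableTopology S]
    [OpensMeasurableSpace S'] [SecondCountableTopology S'] {C : ℝ}
    (hC : ∀ x y : S, dist x y ≤ C) {φ : S → S'} (hφm : Measurable φ)
    (hφ : ∀ x y, dist (φ x) (φ y) ≤ dist x y) (μ ν : ProbabilityMeasure S) :
    W₁ (μ.map (f := φ) hφm.aemeasurable) (ν.map (f := φ) hφm.aemeasurable) ≤ W₁ μ ν := by
  refine le_csInf (couplingCosts_nonempty μ ν) ?_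
  rintro c ⟨π, h1, h2, rfl⟩
  have hm : Measurable (Prod.map φ φ) := hφm.prodMap hφm
  refine (W₁_le_integral (π.map (f := Prod.map φ φ) hm.aemeasurable) ?_ ?_).trans ?_
  · rw [← h1]
    apply Subtype.ext
    change ((π : Measure (S × S)).map _).map _ = ((π : Measure (S × S)).map _).map _
    rw [Measure.map_map measurable_fst hm, Measure.map_map hφm measurable_fst]
    rfl
  · rw [← h2]
    apply Subtype.ext
    change ((π : Measure (S × S)).map _).map _ = ((π : Measure (S × S)).map _).map _
    rw [Measure.map_map measurable_snd hm, Measure.map_map hφm measurable_snd]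
    rfl
  · rw [ProbabilityMeasure.toMeasure_map, integral_map hm.aemeasurable
      (measurable_fst.dist measurable_snd).aestronglyMeasurable]
    refine integral_mono_of_nonneg (Filter.Eventually.of_forall fun _ => dist_nonneg)
      (integrable_dist_of_le hC π) (Filter.Eventually.of_forall fun z => ?_)
    exact hφ _ _

end Wasserstein

lemma dist_Icc_le {L : ℝ} (x y : Icc (0 : ℝ) L) : dist x y ≤ L := by
  rw [Subtype.dist_eq, Real.dist_eq, abs_le]
  have := x.2.1
  have := x.2.2
  have := y.2.1
  have := y.2.2
  constructor <;> linarith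

lemma dist_pathSpace_le {T L : ℝ} (hL : 0 ≤ L) (w w' : PathSpace T L) : dist w w' ≤ L :=
  (ContinuousMap.dist_le hL).2 fun _ => dist_Icc_le _ _

/-- Evaluation at a time is nonexpansive for the uniform metric. Hence one number `W₁ ν ν'` controls
the flows at all times. -/
lemma W₁_marginal_le {T L : ℝ} (hL : 0 ≤ L) (hT : 0 ≤ T) (ν ν' : ProbabilityMeasure (PathSpace T L))
    (t : ℝ) : W₁ (marginal hT ν t) (marginal hT ν' t) ≤ W₁ ν ν' :=
  W₁_map_le (dist_pathSpace_le hL)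
    (continuous_eval_const (F := PathSpace T L) (projIcc 0 T hT t)).measurable
    (fun _ _ => ContinuousMap.dist_apply_le_dist _) ν ν'

/-! ### Expectations under finitely supported laws. -/

section Expect

variable {α β : Type*}

/-- All laws of the chain have finite support, so the series is a finite sum and summability plays
no role for unbounded `c`. -/
lemma expect_eq_sum (P : PMF α) (c : α → ℝ) {s : Finset α} (hs : P.support ⊆ s) :
    expect P c = ∑ a ∈ s, (P a).toReal * c a :=
  tsum_eq_sum fun a ha => by
    have : P a = 0 := by
      by_contra h
      exact ha (hs ((PMF.mem_support_iff _ _).2 h))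
    simp [this]

lemma expect_pure (a : α) (c : α → ℝ) : expect (PMF.pure a) c = c a := by
  rw [expect_eq_sum (s := {a}) _ _ (by simp)]
  simp

lemma support_bind_finite {P : PMF α} {f : α → PMF β} (hP : P.support.Finite)
    (hf : ∀ a, (f a).support.Finite) : (P.bind f).support.Finite := by
  rw [PMF.support_bind]
  exact hP.biUnion fun a _ => hf a

lemma support_map_finite {P : PMF α} (f : α → β) (hP : P.support.Finite) :
    (P.map f).support.Finite := by
  rw [PMF.support_map]
  exact hP.image f

lemma sum_toReal_eq_one {P : PMF α} {s : Finset α} (hs : P.support ⊆ s) :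
    ∑ a ∈ s, (P a).toReal = 1 := by
  rw [← ENNReal.toReal_sum fun a _ => P.apply_ne_top a, ← ENNReal.toReal_one, ← P.tsum_coe]
  congr 1
  exact (tsum_eq_sum fun a ha => by
    by_contra h
    exact ha (hs ((PMF.mem_support_iff _ _).2 h))).symm

lemma expect_bind {P : PMF α} {f : α → PMF β} (hP : P.support.Finite)
    (hf : ∀ a, (f a).support.Finite) (c : β → ℝ) :
    expect (P.bind f) c = expect P fun a => expect (f a) c := by
  classical
  have hs : P.support ⊆ hP.toFinset := by simp
  have ht := support_bind_finite hP hf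
  rw [expect_eq_sum _ _ (s := ht.toFinset) (by simp), expect_eq_sum _ _ hs]
  have h1 : ∀ a ∈ hP.toFinset, (P a).toReal * expect (f a) c
      = ∑ b ∈ ht.toFinset, (P a).toReal * ((f a b).toReal * c b) := by
    intro a ha
    rw [expect_eq_sum (f a) c (s := ht.toFinset), Finset.mul_sum]
    intro b hb
    rw [Set.Finite.coe_toFinset, PMF.mem_support_bind_iff]
    exact ⟨a, by simpa using ha, hb⟩
  rw [Finset.sum_congr rfl h1, Finset.sum_comm]
  refine Finset.sum_congr rfl fun b _ => ?_
  rw [PMF.bind_apply, tsum_eq_sum (s := hP.toFinset) fun a ha => ?_, ENNReal.toReal_sum,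
    Finset.sum_mul]
  · refine Finset.sum_congr rfl fun a _ => ?_
    rw [ENNReal.toReal_mul, mul_assoc]
  · intro a _
    exact ENNReal.mul_ne_top (P.apply_ne_top a) ((f a).apply_ne_top b)
  · have : P a = 0 := by
      by_contra h
      exact ha (by simpa using h)
    simp [this]

lemma expect_map {P : PMF α} (hP : P.support.Finite) (f : α → β) (c : β → ℝ) :
    expect (P.map f) c = expect P (c ∘ f) := by
  rw [PMF.map, expect_bind hP fun a => by simp]
  simp [expect_pure, Function.comp_def]

lemma expect_mono {P : PMF α} (hP : P.support.Finite) {c c' : α → ℝ}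
    (h : ∀ a ∈ P.support, c a ≤ c' a) : expect P c ≤ expect P c' := by
  rw [expect_eq_sum _ _ (s := hP.toFinset) (by simp),
    expect_eq_sum _ _ (s := hP.toFinset) (by simp)]
  refine Finset.sum_le_sum fun a ha => mul_le_mul_of_nonneg_left (h a ?_) ENNReal.toReal_nonneg
  simpa using ha

lemma expect_congr {P : PMF α} (hP : P.support.Finite) {c c' : α → ℝ}
    (h : ∀ a ∈ P.support, c a = c' a) : expect P c = expect P c' :=
  le_antisymm (expect_mono hP fun a ha => (h a ha).le) (expect_mono hP fun a ha => (h a ha).ge)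

lemma expect_affine {P : PMF α} (hP : P.support.Finite) (c : α → ℝ) (a b : ℝ) :
    expect P (fun x => a * c x + b) = a * expect P c + b := by
  rw [expect_eq_sum _ _ (s := hP.toFinset) (by simp),
    expect_eq_sum _ _ (s := hP.toFinset) (by simp), Finset.mul_sum]
  have h := sum_toReal_eq_one (P := P) (s := hP.toFinset) (by simp)
  calc _ = ∑ x ∈ hP.toFinset, (a * ((P x).toReal * c x) + (P x).toReal * b) :=
        Finset.sum_congr rfl fun x _ => by ring
    _ = _ := by rw [Finset.sum_add_distrib, ← Finset.sum_mul, h, one_mul]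

lemma coin_support_finite (p : Icc (0 : ℝ) 1) : (coin p).support.Finite := Set.toFinite _

lemma expect_coin (p : Icc (0 : ℝ) 1) (c : Bool → ℝ) :
    expect (coin p) c = p * c true + (1 - p) * c false := by
  rw [expect_eq_sum _ _ (s := Finset.univ) (fun a _ => by simp), Fintype.sum_bool]
  simp [coin, p.2.1, ENNReal.toReal_ofReal, sub_nonneg.2 p.2.2]

end Expect

/-! ### The grid, and the regularity of the data with named constants. -/

namespace Mesh

variable {L T σ : ℝ} (G : Mesh L T σ)

lemma Δ_nonneg : 0 ≤ G.Δ := by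
  unfold Δ
  positivity

lemma h_sq (hσ : 0 < σ) : G.h ^ 2 = G.Δ * σ ^ 2 := by
  unfold Δ
  field_simp

lemma time_nonneg (j : ℕ) : 0 ≤ G.time j := mul_nonneg (Nat.cast_nonneg _) G.Δ_nonneg

lemma time_le {j : ℕ} (hj : j ≤ G.N) : G.time j ≤ T :=
  calc G.time j ≤ G.N * G.Δ :=
        mul_le_mul_of_nonneg_right (Nat.cast_le.2 hj) G.Δ_nonneg
    _ = T := G.N_mul_Δ

lemma time_mem {T₀ : ℝ} (hT : T ≤ T₀) {j : ℕ} (hj : j ≤ G.N) : G.time j ∈ Icc 0 T₀ :=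
  ⟨G.time_nonneg j, (G.time_le hj).trans hT⟩

lemma pos_mem {k : ℤ} (hk : k ∈ Icc (0 : ℤ) G.K) : G.pos k ∈ Icc 0 L := by
  have h1 : (0 : ℝ) ≤ k := by exact_mod_cast hk.1
  have h2 : (k : ℝ) ≤ G.K := by exact_mod_cast hk.2
  exact ⟨mul_nonneg h1 G.h_pos.le,
    (mul_le_mul_of_nonneg_right h2 G.h_pos.le).trans_eq G.K_mul_h⟩

lemma reflect_mem {z : ℤ} (hz : z ∈ Icc (-1 : ℤ) (G.K + 1)) : G.reflect z ∈ Icc (0 : ℤ) G.K := by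
  obtain ⟨h1, h2⟩ := hz
  unfold reflect
  rw [mem_Icc]
  split_ifs <;> omega

lemma reflect_of_mem {k : ℤ} (hk : k ∈ Icc (0 : ℤ) G.K) : G.reflect k = k := by
  obtain ⟨h1, h2⟩ := hk
  unfold reflect
  split_ifs <;> omega

end Mesh

/-- Quantitative form of the regularity of the data, with constants `c` (Lipschitz), `cB` (bound
of the drift) and `cR` (bound of the reflection costs). -/
structure Data.Regular {L : ℝ} (D : Data L) (T₀ c cB cR : ℝ) : Prop where
  c_nonneg : 0 ≤ c
  cB_nonneg : 0 ≤ cB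
  cR_nonneg : 0 ≤ cR
  f_lip : ∀ t ∈ Icc 0 T₀, ∀ η η' : ProbabilityMeasure (Icc (0 : ℝ) L),
    ∀ x ∈ Icc 0 L, ∀ x' ∈ Icc 0 L, ∀ u ∈ D.U,
      |D.f t η x u - D.f t η' x' u| ≤ c * (W₁ η η' + |x - x'|)
  b_lip : ∀ t ∈ Icc 0 T₀, ∀ η η' : ProbabilityMeasure (Icc (0 : ℝ) L),
    ∀ x ∈ Icc 0 L, ∀ x' ∈ Icc 0 L, ∀ u ∈ D.U, ∀ u' ∈ D.U,
      |D.b t η x u - D.b t η' x' u'| ≤ c * (W₁ η η' + |x - x'| + |u - u'|)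
  g_lip : ∀ η η' : ProbabilityMeasure (Icc (0 : ℝ) L), ∀ x ∈ Icc 0 L, ∀ x' ∈ Icc 0 L,
      |D.g η x - D.g η' x'| ≤ c * (W₁ η η' + |x - x'|)
  y_lip : ∀ t ∈ Icc 0 T₀, ∀ t' ∈ Icc 0 T₀, |D.y t - D.y t'| ≤ c * |t - t'|
  r_lip : ∀ t ∈ Icc 0 T₀, ∀ t' ∈ Icc 0 T₀, |D.r t - D.r t'| ≤ c * |t - t'|
  b_bound : ∀ t ∈ Icc 0 T₀, ∀ η : ProbabilityMeasure (Icc (0 : ℝ) L), ∀ x ∈ Icc 0 L, ∀ u ∈ D.U,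
      |D.b t η x u| ≤ cB
  y_bound : ∀ t ∈ Icc 0 T₀, |D.y t| ≤ cR
  r_bound : ∀ t ∈ Icc 0 T₀, |D.r t| ≤ cR

/-! ### Dynamic programming. -/

section Chain

variable {L T : ℝ} (D : Data L) (G : Mesh L T D.σ) (ν : ProbabilityMeasure (PathSpace T L))
  (αhat : ℝ → ProbabilityMeasure (Icc (0 : ℝ) L) → ℝ → ℝ → ℝ)

lemma rateStep_support_finite (j : ℕ) (k : ℤ) (u : ℝ) :
    (rateStep D G ν j k u).support.Finite :=
  support_map_finite _ (coin_support_finite _)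

lemma chainLaw_support_finite (π : RawPolicy) (i : ℕ) (k : ℤ) (m : ℕ) :
    (chainLaw D G ν π i k m).support.Finite := by
  induction m with
  | zero => simp [chainLaw]
  | succ m ih =>
    exact support_bind_finite ih fun Z => support_map_finite _ (rateStep_support_finite _ _ _ _ _ _)

lemma expect_chainLaw_succ (π : RawPolicy) (i : ℕ) (k : ℤ) (m : ℕ)
    (C : (Fin (m + 1 + 1) → ℤ) → ℝ) :
    expect (chainLaw D G ν π i k (m + 1)) C
      = expect (chainLaw D G ν π i k m) fun Z =>
        expect (rateStep D G ν (i + m) (G.reflect (Z (Fin.last m))) (π m Z)) fun z =>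
          C (Fin.snoc (α := fun _ => ℤ) Z z) := by
  rw [chainLaw, expect_bind (chainLaw_support_finite _ _ _ _ _ _ _)
    fun Z => support_map_finite _ (rateStep_support_finite _ _ _ _ _ _)]
  congr 1
  funext Z
  rw [expect_map (rateStep_support_finite _ _ _ _ _ _)]
  rfl

lemma expect_rateStep (j : ℕ) (k : ℤ) (u : ℝ) (c : ℤ → ℝ) :
    expect (rateStep D G ν j k u) c
      = upProb D G ν j k u * c (k + 1) + (1 - upProb D G ν j k u) * c (k - 1) := by
  rw [rateStep, expect_map (coin_support_finite _), expect_coin]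
  simp

lemma mem_of_mem_support_rateStep {j : ℕ} {k : ℤ} {u : ℝ} {z : ℤ}
    (hz : z ∈ (rateStep D G ν j k u).support) : z = k + 1 ∨ z = k - 1 := by
  rw [rateStep, PMF.mem_support_map_iff] at hz
  obtain ⟨b, -, rfl⟩ := hz
  cases b <;> simp

lemma last_mem_of_mem_support_chainLaw (π : RawPolicy) (i : ℕ) {k : ℤ}
    (hk : k ∈ Icc (0 : ℤ) G.K) (m : ℕ) :
    ∀ Z ∈ (chainLaw D G ν π i k m).support, G.reflect (Z (Fin.last m)) ∈ Icc (0 : ℤ) G.K := by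
  induction m with
  | zero =>
    intro Z hZ
    rw [chainLaw, PMF.mem_support_pure_iff] at hZ
    subst hZ
    rwa [G.reflect_of_mem hk]
  | succ m ih =>
    intro Z hZ
    rw [chainLaw, PMF.mem_support_bind_iff] at hZ
    obtain ⟨Y, hY, hZ⟩ := hZ
    rw [PMF.mem_support_map_iff] at hZ
    obtain ⟨z, hz, rfl⟩ := hZ
    rw [Fin.snoc_last]
    obtain ⟨h1, h2⟩ := ih Y hY
    refine G.reflect_mem ?_
    rw [mem_Icc]
    rcases mem_of_mem_support_rateStep D G ν hz with rfl | rfl <;> omega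

/-- The minimized Hamiltonian at a grid point. -/
def ham (j : ℕ) (k : ℤ) (p : ℝ) : ℝ :=
  D.f (G.time j) (flow D G ν j) (G.pos k) (αhat (G.time j) (flow D G ν j) (G.pos k) p)
    + D.b (G.time j) (flow D G ν j) (G.pos k) (αhat (G.time j) (flow D G ν j) (G.pos k) p) * p

/-- The extension of a function on `{0, …, K}` to `{-1, …, K + 1}` by the costs of reflection. -/
def extend (j : ℕ) (φ : ℤ → ℝ) (k : ℤ) : ℝ :=
  if k = -1 then D.y (G.time j) * G.h + φ 0
  else if k = G.K + 1 then D.r (G.time j) * G.h + φ G.K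
  else φ k

/-- The backward operator of the dynamic programming equation. -/
def bellman (j : ℕ) (φ : ℤ → ℝ) (k : ℤ) : ℝ :=
  (extend D G (j + 1) φ (k + 1) + extend D G (j + 1) φ (k - 1)) / 2
    + G.Δ * ham D G ν αhat j k
        ((extend D G (j + 1) φ (k + 1) - extend D G (j + 1) φ (k - 1)) / (2 * G.h))

/-- The solution of the dynamic programming equation, indexed by the number of steps to go. -/
def dpValue : ℕ → ℤ → ℝ
  | 0 => fun k => D.g (flow D G ν G.N) (G.pos k)
  | n + 1 => bellman D G ν αhat (G.N - (n + 1)) (dpValue n)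

lemma extend_eq (j : ℕ) (φ : ℤ → ℝ) (z : ℤ) :
    extend D G j φ z = (if z = -1 then D.y (G.time j) * G.h else 0)
      + (if z = G.K + 1 then D.r (G.time j) * G.h else 0) + φ (G.reflect z) := by
  unfold extend Mesh.reflect
  split_ifs <;> first | omega | ring

/-- The running and reflection costs along a trajectory. -/
def runCost (π : RawPolicy) (i m : ℕ) (Z : Fin (m + 1) → ℤ) : ℝ :=
  ∑ l : Fin m,
    (G.Δ * D.f (G.time (i + l)) (flow D G ν (i + l)) (G.pos (G.reflect (Z l.castSucc)))
        (π l (history Z l))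
      + (if Z l.succ = -1 then D.y (G.time (i + l + 1)) * G.h else 0)
      + (if Z l.succ = G.K + 1 then D.r (G.time (i + l + 1)) * G.h else 0))

/-- The cost of the last reflection and a terminal cost paid after it combine into `extend`. This
peels off the last step, as the recursive construction of `chainLaw` requires. -/
lemma runCost_snoc (π : RawPolicy) (i m : ℕ) (Z : Fin (m + 1) → ℤ) (z : ℤ) (φ : ℤ → ℝ) :
    runCost D G ν π i (m + 1) (Fin.snoc (α := fun _ => ℤ) Z z) + φ (G.reflect z)
      = runCost D G ν π i m Z
        + G.Δ * D.f (G.time (i + m)) (flow D G ν (i + m)) (G.pos (G.reflect (Z (Fin.last m))))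
            (π m Z)
        + extend D G (i + m + 1) φ z := by
  rw [extend_eq, runCost, runCost, Fin.sum_univ_castSucc]
  have hlast : history (Fin.snoc (α := fun _ => ℤ) Z z : Fin (m + 1 + 1) → ℤ) (Fin.last m) = Z := by
    funext a
    exact Fin.snoc_castSucc (α := fun _ => ℤ) z Z a
  have hcast : ∀ l : Fin m,
      history (Fin.snoc (α := fun _ => ℤ) Z z : Fin (m + 1 + 1) → ℤ) l.castSucc
        = history Z l := by
    intro l
    funext a
    exact Fin.snoc_castSucc (α := fun _ => ℤ) z Z (Fin.castLE (Nat.succ_le_succ l.isLt.le) a)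
  rw [hlast]
  simp only [hcast]
  have e1 : ∀ l : Fin m, (Fin.snoc (α := fun _ => ℤ) Z z : Fin (m + 1 + 1) → ℤ) l.castSucc.succ
      = Z l.succ := by
    intro l
    rw [← Fin.castSucc_succ]
    exact Fin.snoc_castSucc (α := fun _ => ℤ) z Z l.succ
  simp only [e1, Fin.snoc_castSucc, Fin.succ_last, Fin.snoc_last, Fin.val_castSucc, Fin.val_last]
  ring

variable {D G ν αhat}
variable {T₀ c cB cR : ℝ}

/-- The clamp to `[0,1]` is inactive because `h |b| ≤ h cB ≤ σ²`. -/
lemma coe_upProb (hreg : D.Regular T₀ c cB cR) (hσ : 0 < D.σ) (hT : T ≤ T₀)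
    (hh : G.h * cB ≤ D.σ ^ 2) {j : ℕ} (hj : j ≤ G.N) {k : ℤ} (hk : k ∈ Icc (0 : ℤ) G.K)
    {u : ℝ} (hu : u ∈ D.U) :
    (upProb D G ν j k u : ℝ)
      = (G.h * D.b (G.time j) (flow D G ν j) (G.pos k) u + D.σ ^ 2) / (2 * D.σ ^ 2) := by
  have hb := hreg.b_bound _ (G.time_mem hT hj) (flow D G ν j) _ (G.pos_mem hk) u hu
  have hb' : |G.h * D.b (G.time j) (flow D G ν j) (G.pos k) u| ≤ D.σ ^ 2 := by
    rw [abs_mul, abs_of_pos G.h_pos]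
    exact (mul_le_mul_of_nonneg_left hb G.h_pos.le).trans hh
  have hs : 0 < D.σ ^ 2 := by positivity
  rw [abs_le] at hb'
  unfold upProb
  rw [projIcc_of_mem]
  rw [mem_Icc, le_div_iff₀ (by positivity), div_le_iff₀ (by positivity)]
  constructor <;> linarith [hb'.1, hb'.2]

/-- The bias of the step is `h b / σ²`, and `Δ = h² / σ²` turns it into `Δ` times the drift times
the central difference. The control enters only through this term, which is why minimizing the
Hamiltonian is the right local problem. -/
lemma expect_rateStep_eq (hreg : D.Regular T₀ c cB cR) (hσ : 0 < D.σ) (hT : T ≤ T₀)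
    (hh : G.h * cB ≤ D.σ ^ 2) {j : ℕ} (hj : j ≤ G.N) {k : ℤ} (hk : k ∈ Icc (0 : ℤ) G.K)
    {u : ℝ} (hu : u ∈ D.U) (φ : ℤ → ℝ) :
    expect (rateStep D G ν j k u) φ = (φ (k + 1) + φ (k - 1)) / 2
      + G.Δ * (D.b (G.time j) (flow D G ν j) (G.pos k) u
        * ((φ (k + 1) - φ (k - 1)) / (2 * G.h))) := by
  rw [expect_rateStep, coe_upProb hreg hσ hT hh hj hk hu]
  have := G.h_pos
  unfold Mesh.Δ
  field_simp
  ring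

lemma ham_le (hmin : D.IsUniqueMinimizer T₀ αhat) (hT : T ≤ T₀) {j : ℕ} (hj : j ≤ G.N) {k : ℤ}
    (hk : k ∈ Icc (0 : ℤ) G.K) {u : ℝ} (hu : u ∈ D.U) (p : ℝ) :
    ham D G ν αhat j k p ≤ D.f (G.time j) (flow D G ν j) (G.pos k) u
      + D.b (G.time j) (flow D G ν j) (G.pos k) u * p := by
  by_cases h : u = αhat (G.time j) (flow D G ν j) (G.pos k) p
  · rw [h, ham]
  · exact ((hmin _ (G.time_mem hT hj) _ _ (G.pos_mem hk) p).2 u hu h).le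

/-- The expected cost up to step `m`, with `dpValue` as the terminal cost. -/
def partialCost (D : Data L) (G : Mesh L T D.σ) (ν : ProbabilityMeasure (PathSpace T L))
    (αhat : ℝ → ProbabilityMeasure (Icc (0 : ℝ) L) → ℝ → ℝ → ℝ) (π : RawPolicy) (i : ℕ) (k : ℤ)
    (m : ℕ) : ℝ :=
  expect (chainLaw D G ν π i k m) fun Z => runCost D G ν π i m Z
    + dpValue D G ν αhat (G.N - (i + m)) (G.reflect (Z (Fin.last m)))

lemma partialCost_succ (hreg : D.Regular T₀ c cB cR) (hσ : 0 < D.σ) (hT : T ≤ T₀)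
    (hh : G.h * cB ≤ D.σ ^ 2) {π : RawPolicy} (hπ : ∀ m Z, π m Z ∈ D.U) {i : ℕ} {k : ℤ}
    (hk : k ∈ Icc (0 : ℤ) G.K) {m : ℕ} (hm : i + m < G.N) :
    partialCost D G ν αhat π i k (m + 1)
      = expect (chainLaw D G ν π i k m) fun Z =>
        let x := G.reflect (Z (Fin.last m))
        let v := extend D G (i + m + 1) (dpValue D G ν αhat (G.N - (i + m + 1)))
        runCost D G ν π i m Z + ((v (x + 1) + v (x - 1)) / 2
          + G.Δ * (D.f (G.time (i + m)) (flow D G ν (i + m)) (G.pos x) (π m Z)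
            + D.b (G.time (i + m)) (flow D G ν (i + m)) (G.pos x) (π m Z)
              * ((v (x + 1) - v (x - 1)) / (2 * G.h)))) := by
  rw [partialCost, expect_chainLaw_succ]
  refine expect_congr (chainLaw_support_finite _ _ _ _ _ _ _) fun Z hZ => ?_
  have hx := last_mem_of_mem_support_chainLaw D G ν π i hk m Z hZ
  simp only [Fin.snoc_last, ← add_assoc, runCost_snoc]
  have h1 := expect_affine (rateStep_support_finite D G ν (i + m) (G.reflect (Z (Fin.last m)))
    (π m Z)) (extend D G (i + m + 1) (dpValue D G ν αhat (G.N - (i + m + 1)))) 1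
    (runCost D G ν π i m Z + G.Δ * D.f (G.time (i + m)) (flow D G ν (i + m))
      (G.pos (G.reflect (Z (Fin.last m)))) (π m Z))
  rw [show (fun z => runCost D G ν π i m Z + G.Δ * D.f (G.time (i + m)) (flow D G ν (i + m))
      (G.pos (G.reflect (Z (Fin.last m)))) (π m Z)
      + extend D G (i + m + 1) (dpValue D G ν αhat (G.N - (i + m + 1))) z)
    = fun z => 1 * extend D G (i + m + 1) (dpValue D G ν αhat (G.N - (i + m + 1))) z
      + (runCost D G ν π i m Z + G.Δ * D.f (G.time (i + m)) (flow D G ν (i + m))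
      (G.pos (G.reflect (Z (Fin.last m)))) (π m Z)) by funext z; ring, h1,
    expect_rateStep_eq hreg hσ hT hh hm.le hx (hπ m Z)]
  ring

lemma dpValue_eq_bellman {j : ℕ} (hj : j < G.N) :
    dpValue D G ν αhat (G.N - j) = bellman D G ν αhat j (dpValue D G ν αhat (G.N - (j + 1))) := by
  obtain ⟨n, hn⟩ : ∃ n, G.N = j + (n + 1) := ⟨G.N - j - 1, by omega⟩
  rw [show G.N - j = n + 1 by omega, show G.N - (j + 1) = n by omega, dpValue,
    show G.N - (n + 1) = j by omega]

lemma partialCost_zero {π : RawPolicy} {i : ℕ} {k : ℤ} (hk : k ∈ Icc (0 : ℤ) G.K) :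
    partialCost D G ν αhat π i k 0 = dpValue D G ν αhat (G.N - i) k := by
  rw [partialCost, chainLaw, expect_pure, G.reflect_of_mem hk]
  simp [runCost]

lemma partialCost_last {π : RawPolicy} {i : ℕ} {k : ℤ} (hi : i ≤ G.N) :
    partialCost D G ν αhat π i k (G.N - i) = J D G ν π i k := by
  rw [partialCost, show G.N - (i + (G.N - i)) = 0 by omega]
  rfl

/-- Verification argument: `partialCost` is nondecreasing in `m` for every admissible policy, and it
interpolates between the solution of the dynamic programming equation at `m = 0` and the true cost
at `m = N - i`. -/
lemma dpValue_le_J (hreg : D.Regular T₀ c cB cR) (hσ : 0 < D.σ) (hT : T ≤ T₀)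
    (hh : G.h * cB ≤ D.σ ^ 2) (hmin : D.IsUniqueMinimizer T₀ αhat) {π : RawPolicy}
    (hπ : ∀ m Z, π m Z ∈ D.U) {i : ℕ} (hi : i ≤ G.N) {k : ℤ} (hk : k ∈ Icc (0 : ℤ) G.K) :
    dpValue D G ν αhat (G.N - i) k ≤ J D G ν π i k := by
  have key : ∀ m, i + m ≤ G.N →
      dpValue D G ν αhat (G.N - i) k ≤ partialCost D G ν αhat π i k m := by
    intro m
    induction m with
    | zero => exact fun _ => (partialCost_zero hk).ge
    | succ m ih =>
      intro hm
      refine (ih (by omega)).trans ?_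
      rw [partialCost_succ hreg hσ hT hh hπ hk (by omega)]
      refine expect_mono (chainLaw_support_finite _ _ _ _ _ _ _) fun Z hZ => ?_
      have hx := last_mem_of_mem_support_chainLaw D G ν π i hk m Z hZ
      rw [dpValue_eq_bellman (j := i + m) (by omega)]
      refine add_le_add_right (add_le_add_right (mul_le_mul_of_nonneg_left ?_ G.Δ_nonneg) _) _
      exact ham_le hmin hT (by omega) hx (hπ m Z) _
  rw [← partialCost_last (αhat := αhat) hi]
  exact key _ (by omega)

open Classical in
-- Under the minimizing feedback every inequality of the verification argument is an equality, so
-- `partialCost` is constant in `m`.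
lemma exists_policy_J_eq (hreg : D.Regular T₀ c cB cR) (hσ : 0 < D.σ) (hT : T ≤ T₀)
    (hh : G.h * cB ≤ D.σ ^ 2) (hmin : D.IsUniqueMinimizer T₀ αhat) {i : ℕ} (hi : i ≤ G.N) {k : ℤ}
    (hk : k ∈ Icc (0 : ℤ) G.K) :
    ∃ π : Policy D.U, J D G ν π.1 i k = dpValue D G ν αhat (G.N - i) k := by
  have hU : D.U.Nonempty := ⟨_, (hmin _ (G.time_mem hT hi) (flow D G ν i) _ (G.pos_mem hk) 0).1⟩
  obtain ⟨u₀, hu₀⟩ := hU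
  -- A policy must take values in `U` on every history, but `αhat` is known to do so only at grid
  -- points and times up to `T₀`; elsewhere the default `u₀` is used. The clock is `i + m`, since
  -- `m` counts steps from the starting time.
  let fb : RawPolicy := fun m Z =>
    let x := G.reflect (Z (Fin.last m))
    let v := extend D G (i + m + 1) (dpValue D G ν αhat (G.N - (i + m + 1)))
    if i + m < G.N ∧ x ∈ Icc (0 : ℤ) G.K then
      αhat (G.time (i + m)) (flow D G ν (i + m)) (G.pos x) ((v (x + 1) - v (x - 1)) / (2 * G.h))
    else u₀
  have hfb : ∀ m Z, fb m Z ∈ D.U := by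
    intro m Z
    simp only [fb]
    split_ifs with h
    · exact (hmin _ (G.time_mem hT h.1.le) _ _ (G.pos_mem h.2) _).1
    · exact hu₀
  refine ⟨⟨fb, hfb⟩, ?_⟩
  have key : ∀ m, i + m ≤ G.N →
      partialCost D G ν αhat fb i k m = dpValue D G ν αhat (G.N - i) k := by
    intro m
    induction m with
    | zero => exact fun _ => partialCost_zero hk
    | succ m ih =>
      intro hm
      rw [← ih (by omega), partialCost_succ hreg hσ hT hh hfb hk (by omega)]
      refine expect_congr (chainLaw_support_finite _ _ _ _ _ _ _) fun Z hZ => ?_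
      have hx := last_mem_of_mem_support_chainLaw D G ν fb i hk m Z hZ
      rw [dpValue_eq_bellman (j := i + m) (by omega)]
      have hc : i + m < G.N ∧ G.reflect (Z (Fin.last m)) ∈ Icc (0 : ℤ) G.K := ⟨by omega, hx⟩
      simp only [fb, if_pos hc]
      rfl
  rw [← partialCost_last (αhat := αhat) hi]
  exact key _ (by omega)

/-- The value function solves the dynamic programming equation. -/
theorem V_eq_dpValue (hreg : D.Regular T₀ c cB cR) (hσ : 0 < D.σ) (hT : T ≤ T₀)
    (hh : G.h * cB ≤ D.σ ^ 2) (hmin : D.IsUniqueMinimizer T₀ αhat) {i : ℕ} (hi : i ≤ G.N) {k : ℤ}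
    (hk : k ∈ Icc (0 : ℤ) G.K) : V D G ν i k = dpValue D G ν αhat (G.N - i) k := by
  obtain ⟨π₀, hπ₀⟩ := exists_policy_J_eq (ν := ν) hreg hσ hT hh hmin hi hk
  have hle : ∀ π : Policy D.U, dpValue D G ν αhat (G.N - i) k ≤ J D G ν π.1 i k :=
    fun π => dpValue_le_J hreg hσ hT hh hmin π.2 hi hk
  have : Nonempty (Policy D.U) := ⟨π₀⟩
  refine le_antisymm ?_ (le_ciInf hle)
  rw [← hπ₀]
  exact ciInf_le ⟨_, by rintro _ ⟨π, rfl⟩; exact hle π⟩ π₀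

lemma extend_congr {φ ψ : ℤ → ℝ} (h : ∀ k ∈ Icc (0 : ℤ) G.K, φ k = ψ k) (j : ℕ) {z : ℤ}
    (hz : z ∈ Icc (-1 : ℤ) (G.K + 1)) : extend D G j φ z = extend D G j ψ z := by
  rw [extend_eq, extend_eq, h _ (G.reflect_mem hz)]

lemma V_terminal (hreg : D.Regular T₀ c cB cR) (hσ : 0 < D.σ) (hT : T ≤ T₀)
    (hh : G.h * cB ≤ D.σ ^ 2) (hmin : D.IsUniqueMinimizer T₀ αhat) {k : ℤ}
    (hk : k ∈ Icc (0 : ℤ) G.K) : V D G ν G.N k = D.g (flow D G ν G.N) (G.pos k) := by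
  rw [V_eq_dpValue hreg hσ hT hh hmin le_rfl hk, Nat.sub_self]
  rfl

/-- The dynamic programming equation of the value function. -/
lemma V_recursion (hreg : D.Regular T₀ c cB cR) (hσ : 0 < D.σ) (hT : T ≤ T₀)
    (hh : G.h * cB ≤ D.σ ^ 2) (hmin : D.IsUniqueMinimizer T₀ αhat) {j : ℕ} (hj : j < G.N) {k : ℤ}
    (hk : k ∈ Icc (0 : ℤ) G.K) :
    V D G ν j k = (Vext D G ν (j + 1) (k + 1) + Vext D G ν (j + 1) (k - 1)) / 2
      + G.Δ * ham D G ν αhat j k (gradV D G ν j k) := by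
  have h : ∀ z ∈ Icc (-1 : ℤ) (G.K + 1), Vext D G ν (j + 1) z
      = extend D G (j + 1) (dpValue D G ν αhat (G.N - (j + 1))) z := fun z hz =>
    extend_congr (φ := V D G ν (j + 1))
      (fun k hk => V_eq_dpValue hreg hσ hT hh hmin hj hk) (j + 1) hz
  have h1 : k + 1 ∈ Icc (-1 : ℤ) (G.K + 1) := by
    rw [mem_Icc] at hk ⊢
    omega
  have h2 : k - 1 ∈ Icc (-1 : ℤ) (G.K + 1) := by
    rw [mem_Icc] at hk ⊢
    omega
  rw [V_eq_dpValue hreg hσ hT hh hmin hj.le hk, dpValue_eq_bellman hj, gradV, h _ h1, h _ h2]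
  rfl

end Chain

/-! ### The uniform gradient bound. -/

section Gradient

variable {L T : ℝ} {D : Data L} {G : Mesh L T D.σ} {ν ν' : ProbabilityMeasure (PathSpace T L)}
  {αhat : ℝ → ProbabilityMeasure (Icc (0 : ℝ) L) → ℝ → ℝ → ℝ} {T₀ c cB cR : ℝ}

/-- The minimizer of the right-hand problem serves as a trial control in the left-hand one, so the
Lipschitz property of `αhat` is not needed. Only `p'` has to be bounded, because it multiplies the
increment of `b`. -/
lemma ham_le_ham_add (hreg : D.Regular T₀ c cB cR) (hT : T ≤ T₀)
    (hmin : D.IsUniqueMinimizer T₀ αhat) {j : ℕ} (hj : j ≤ G.N) {k k' : ℤ}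
    (hk : k ∈ Icc (0 : ℤ) G.K) (hk' : k' ∈ Icc (0 : ℤ) G.K) {p p' P : ℝ} (hp' : |p'| ≤ P) :
    ham D G ν αhat j k p ≤ ham D G ν' αhat j k' p' + (cB * |p - p'|
      + c * (1 + P) * (W₁ (flow D G ν j) (flow D G ν' j) + |G.pos k - G.pos k'|)) := by
  have hx := G.pos_mem hk
  have hx' := G.pos_mem hk'
  have ht := G.time_mem hT hj
  have hu := (hmin _ ht (flow D G ν' j) _ hx' p').1
  have h1 := ham_le (ν := ν) hmin hT hj hk hu p
  have hf := hreg.f_lip _ ht (flow D G ν j) (flow D G ν' j) _ hx _ hx' _ hu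
  have hb := hreg.b_lip _ ht (flow D G ν j) (flow D G ν' j) _ hx _ hx' _ hu _ hu
  have hB := hreg.b_bound _ ht (flow D G ν j) _ hx _ hu
  refine h1.trans ?_
  unfold ham
  set u := αhat (G.time j) (flow D G ν' j) (G.pos k') p'
  set W := W₁ (flow D G ν j) (flow D G ν' j)
  rw [sub_self, abs_zero, add_zero] at hb
  have e1 : D.b (G.time j) (flow D G ν j) (G.pos k) u * p
      - D.b (G.time j) (flow D G ν' j) (G.pos k') u * p'
      ≤ cB * |p - p'| + c * (W + |G.pos k - G.pos k'|) * P := by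
    have : D.b (G.time j) (flow D G ν j) (G.pos k) u * p
      - D.b (G.time j) (flow D G ν' j) (G.pos k') u * p'
      = D.b (G.time j) (flow D G ν j) (G.pos k) u * (p - p')
        + (D.b (G.time j) (flow D G ν j) (G.pos k) u
          - D.b (G.time j) (flow D G ν' j) (G.pos k') u) * p' := by ring
    rw [this]
    refine add_le_add ?_ ?_
    · refine (le_abs_self _).trans ?_
      rw [abs_mul]
      exact mul_le_mul_of_nonneg_right hB (abs_nonneg _)
    · refine (le_abs_self _).trans ?_
      rw [abs_mul]
      exact mul_le_mul hb hp' (abs_nonneg _) ((abs_nonneg _).trans hb)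
  have e2 := (le_abs_self _).trans hf
  linarith

lemma abs_ham_sub_le (hreg : D.Regular T₀ c cB cR) (hT : T ≤ T₀)
    (hmin : D.IsUniqueMinimizer T₀ αhat) {j : ℕ} (hj : j ≤ G.N) {k k' : ℤ}
    (hk : k ∈ Icc (0 : ℤ) G.K) (hk' : k' ∈ Icc (0 : ℤ) G.K) {p p' P : ℝ} (hp : |p| ≤ P)
    (hp' : |p'| ≤ P) {w : ℝ} (hw : W₁ (flow D G ν j) (flow D G ν' j) ≤ w)
    (hw' : W₁ (flow D G ν' j) (flow D G ν j) ≤ w) :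
    |ham D G ν αhat j k p - ham D G ν' αhat j k' p'|
      ≤ cB * |p - p'| + c * (1 + P) * (w + |G.pos k - G.pos k'|) := by
  have hP : 0 ≤ P := (abs_nonneg _).trans hp
  have hc := hreg.c_nonneg
  have h1 := ham_le_ham_add (ν := ν) (ν' := ν') hreg hT hmin hj hk hk' (p := p) hp'
  have h2 := ham_le_ham_add (ν := ν') (ν' := ν) hreg hT hmin hj hk' hk (p := p') hp
  have h3 : c * (1 + P) * (W₁ (flow D G ν j) (flow D G ν' j) + |G.pos k - G.pos k'|)
      ≤ c * (1 + P) * (w + |G.pos k - G.pos k'|) :=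
    mul_le_mul_of_nonneg_left (by linarith) (by positivity)
  have h4 : c * (1 + P) * (W₁ (flow D G ν' j) (flow D G ν j) + |G.pos k - G.pos k'|)
      ≤ c * (1 + P) * (w + |G.pos k - G.pos k'|) :=
    mul_le_mul_of_nonneg_left (by linarith) (by positivity)
  rw [abs_sub_comm p' p, abs_sub_comm (G.pos k') (G.pos k)] at h2
  rw [abs_le]
  constructor <;> linarith

/-- The left side equals `max |a| |b|`. In the maximum principle this leaves room for a gradient
term of size exactly `|a - b| / 2`. -/
lemma abs_half_add_le {a b m : ℝ} (ha : |a| ≤ m) (hb : |b| ≤ m) :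
    |(a + b) / 2| + |a - b| / 2 ≤ m := by
  rw [abs_le] at ha hb
  rcases abs_cases ((a + b) / 2) with h | h <;> rcases abs_cases (a - b) with h' | h' <;> linarith

lemma pos_succ_sub (k : ℤ) : G.pos (k + 1) - G.pos k = G.h := by
  unfold Mesh.pos
  push_cast
  ring

lemma Vext_neg_one (j : ℕ) :
    Vext D G ν j (-1) = D.y (G.time j) * G.h + V D G ν j 0 := by simp [Vext]

lemma Vext_succ_K (j : ℕ) :
    Vext D G ν j (G.K + 1) = D.r (G.time j) * G.h + V D G ν j G.K := by
  rw [Vext, if_neg (by omega), if_pos rfl]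

lemma Vext_of_mem (j : ℕ) {k : ℤ} (hk : k ∈ Icc (0 : ℤ) G.K) :
    Vext D G ν j k = V D G ν j k := by
  rw [mem_Icc] at hk
  rw [Vext, if_neg (by omega), if_neg (by omega)]

lemma gradV_eq (j : ℕ) (k : ℤ) :
    gradV D G ν j k = ((Vext D G ν (j + 1) (k + 1) - Vext D G ν (j + 1) k)
      + (Vext D G ν (j + 1) k - Vext D G ν (j + 1) (k - 1))) / (2 * G.h) := by
  unfold gradV
  ring

lemma gradV_succ_sub (j : ℕ) (k : ℤ) :
    gradV D G ν j (k + 1) - gradV D G ν j k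
      = ((Vext D G ν (j + 1) (k + 1 + 1) - Vext D G ν (j + 1) (k + 1))
      - (Vext D G ν (j + 1) k - Vext D G ν (j + 1) (k - 1))) / (2 * G.h) := by
  unfold gradV
  rw [add_sub_cancel_right]
  ring

lemma abs_gradV_le_of (j : ℕ) {k : ℤ} (hk : k ∈ Icc (0 : ℤ) G.K) {P : ℝ}
    (hP : ∀ z ∈ Icc (-1 : ℤ) G.K,
      |Vext D G ν (j + 1) (z + 1) - Vext D G ν (j + 1) z| ≤ P * G.h) :
    |gradV D G ν j k| ≤ P := by
  have h1 := hP k (by rw [mem_Icc] at hk ⊢; omega)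
  have h2 := hP (k - 1) (by rw [mem_Icc] at hk ⊢; omega)
  rw [sub_add_cancel] at h2
  have h := G.h_pos
  rw [gradV_eq, abs_div, abs_of_pos (show 0 < 2 * G.h by positivity), div_le_iff₀ (by positivity)]
  exact (abs_add_le _ _).trans (by linarith)

/-- Discrete maximum principle for the forward differences of the value function. -/
lemma abs_Vext_succ_sub_le_pow (hreg : D.Regular T₀ c cB cR) (hσ : 0 < D.σ) (hT : T ≤ T₀)
    (hh : G.h * cB ≤ D.σ ^ 2) (hmin : D.IsUniqueMinimizer T₀ αhat) :
    ∀ n ≤ G.N, ∀ z ∈ Icc (-1 : ℤ) G.K,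
      |Vext D G ν (G.N - n) (z + 1) - Vext D G ν (G.N - n) z|
        ≤ ((1 + c + cR) * (1 + c * G.Δ) ^ n - 1) * G.h := by
  have hh0 := G.h_pos
  have hΔ := G.Δ_nonneg
  have hc := hreg.c_nonneg
  have hR := hreg.cR_nonneg
  have hBd : ∀ n ≤ G.N, cR * G.h ≤ ((1 + c + cR) * (1 + c * G.Δ) ^ n - 1) * G.h := by
    intro n _
    have : (1 : ℝ) ≤ (1 + c * G.Δ) ^ n := one_le_pow₀ (by nlinarith)
    refine mul_le_mul_of_nonneg_right ?_ hh0.le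
    nlinarith
  -- Across the two edges the difference is a reflection cost, bounded by `cR * G.h` at every time,
  -- so the induction only has to treat interior differences.
  have hbdry : ∀ n ≤ G.N, ∀ z ∈ Icc (-1 : ℤ) G.K, (0 ≤ z → z < G.K →
      |V D G ν (G.N - n) (z + 1) - V D G ν (G.N - n) z|
        ≤ ((1 + c + cR) * (1 + c * G.Δ) ^ n - 1) * G.h) →
      |Vext D G ν (G.N - n) (z + 1) - Vext D G ν (G.N - n) z|
        ≤ ((1 + c + cR) * (1 + c * G.Δ) ^ n - 1) * G.h := by
    intro n hn z hz hint
    rw [mem_Icc] at hz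
    have ht := G.time_mem hT (show G.N - n ≤ G.N by omega)
    rcases eq_or_ne z (-1) with rfl | hz1
    · rw [Vext_neg_one, neg_add_cancel, Vext_of_mem _ (by simp), sub_add_cancel_right, abs_neg,
        abs_mul, abs_of_pos hh0]
      exact (mul_le_mul_of_nonneg_right (hreg.y_bound _ ht) hh0.le).trans (hBd n hn)
    rcases eq_or_ne z G.K with rfl | hz2
    · rw [Vext_succ_K, Vext_of_mem _ (by simp), add_sub_cancel_right, abs_mul, abs_of_pos hh0]
      exact (mul_le_mul_of_nonneg_right (hreg.r_bound _ ht) hh0.le).trans (hBd n hn)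
    rw [Vext_of_mem _ (by rw [mem_Icc]; omega), Vext_of_mem _ (by rw [mem_Icc]; omega)]
    exact hint (by omega) (by omega)
  intro n
  induction n with
  | zero =>
    intro hn z hz
    refine hbdry 0 hn z hz fun h1 h2 => ?_
    have hk : z ∈ Icc (0 : ℤ) G.K := by rw [mem_Icc]; omega
    have hk' : z + 1 ∈ Icc (0 : ℤ) G.K := by rw [mem_Icc]; omega
    rw [Nat.sub_zero, V_terminal hreg hσ hT hh hmin hk, V_terminal hreg hσ hT hh hmin hk']
    refine (hreg.g_lip _ _ _ (G.pos_mem hk') _ (G.pos_mem hk)).trans ?_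
    rw [W₁_self, pos_succ_sub, abs_of_pos hh0, zero_add]
    refine mul_le_mul_of_nonneg_right ?_ hh0.le
    rw [pow_zero]
    linarith
  | succ n ih =>
    intro hn z hz
    refine hbdry (n + 1) hn z hz fun h1 h2 => ?_
    have hk : z ∈ Icc (0 : ℤ) G.K := by rw [mem_Icc]; omega
    have hk' : z + 1 ∈ Icc (0 : ℤ) G.K := by rw [mem_Icc]; omega
    have ih := ih (by omega)
    obtain ⟨j, hj⟩ : ∃ j, G.N = j + (n + 1) := ⟨G.N - (n + 1), by omega⟩
    rw [show G.N - n = j + 1 by omega] at ih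
    rw [show G.N - (n + 1) = j by omega]
    set P : ℝ := (1 + c + cR) * (1 + c * G.Δ) ^ n - 1 with hP
    have hg := abs_gradV_le_of j hk ih
    have hg' := abs_gradV_le_of j hk' ih
    rw [V_recursion hreg hσ hT hh hmin (by omega) hk,
      V_recursion hreg hσ hT hh hmin (by omega) hk']
    have hham := abs_ham_sub_le (ν := ν) (ν' := ν) hreg hT hmin (show j ≤ G.N by omega) hk' hk
      hg' hg (w := 0) (W₁_self _).le (W₁_self _).le
    rw [pos_succ_sub, abs_of_pos hh0, gradV_succ_sub, zero_add] at hham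
    have ha := ih (z + 1) (by rw [mem_Icc]; omega)
    have hb := ih (z - 1) (by rw [mem_Icc]; omega)
    rw [sub_add_cancel] at hb
    set A := Vext D G ν (j + 1) (z + 1 + 1) - Vext D G ν (j + 1) (z + 1)
    set B := Vext D G ν (j + 1) z - Vext D G ν (j + 1) (z - 1)
    set H := ham D G ν αhat j (z + 1) (gradV D G ν j (z + 1))
      - ham D G ν αhat j z (gradV D G ν j z) with hH
    have e1 : (Vext D G ν (j + 1) (z + 1 + 1) + Vext D G ν (j + 1) (z + 1 - 1)) / 2
        + G.Δ * ham D G ν αhat j (z + 1) (gradV D G ν j (z + 1))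
        - ((Vext D G ν (j + 1) (z + 1) + Vext D G ν (j + 1) (z - 1)) / 2
          + G.Δ * ham D G ν αhat j z (gradV D G ν j z)) = (A + B) / 2 + G.Δ * H := by
      rw [add_sub_cancel_right]
      ring
    rw [e1]
    have e2 : |G.Δ * H| ≤ |A - B| / 2 + G.Δ * (c * (1 + P) * G.h) := by
      rw [abs_mul, abs_of_nonneg hΔ]
      refine (mul_le_mul_of_nonneg_left hham hΔ).trans ?_
      rw [mul_add, abs_div, abs_of_pos (show 0 < 2 * G.h by positivity)]
      refine add_le_add_left ?_ _
      -- Equivalent to `hh` through `h² = Δ σ²`. This is monotonicity of the scheme: the first-order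
      -- term fits into the `|A - B| / 2` of `abs_half_add_le`.
      have : G.Δ * cB ≤ G.h := by
        have hs : 0 < D.σ ^ 2 := by positivity
        refine le_of_mul_le_mul_right ?_ hs
        have := G.h_sq hσ
        nlinarith
      calc G.Δ * (cB * (|A - B| / (2 * G.h))) = (G.Δ * cB) * (|A - B| / (2 * G.h)) := by ring
        _ ≤ G.h * (|A - B| / (2 * G.h)) := mul_le_mul_of_nonneg_right this (by positivity)
        _ = |A - B| / 2 := by field_simp
    have e3 := abs_half_add_le ha hb
    -- One step adds `Δ c (1 + P)` to the slope bound `P`, hence multiplies `1 + P` by `1 + c Δ`;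
    -- this explains the form of the bound.
    have e4 : ((1 + c + cR) * (1 + c * G.Δ) ^ (n + 1) - 1) * G.h
        = P * G.h + G.Δ * (c * (1 + P) * G.h) := by
      rw [hP]
      ring
    rw [e4]
    exact (abs_add_le _ _).trans (by linarith)

/-- The uniform bound for the gradient of the value function. -/
def gradBound (T₀ c cR : ℝ) : ℝ := (1 + c + cR) * Real.exp (c * T₀)

lemma abs_Vext_succ_sub_le (hreg : D.Regular T₀ c cB cR) (hσ : 0 < D.σ) (hT : T ≤ T₀)
    (hh : G.h * cB ≤ D.σ ^ 2) (hmin : D.IsUniqueMinimizer T₀ αhat) {j : ℕ} (hj : j ≤ G.N) {z : ℤ}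
    (hz : z ∈ Icc (-1 : ℤ) G.K) :
    |Vext D G ν j (z + 1) - Vext D G ν j z| ≤ gradBound T₀ c cR * G.h := by
  have h := abs_Vext_succ_sub_le_pow (ν := ν) hreg hσ hT hh hmin (G.N - j) (by omega) z hz
  rw [show G.N - (G.N - j) = j by omega] at h
  have hc := hreg.c_nonneg
  have hR := hreg.cR_nonneg
  refine h.trans (mul_le_mul_of_nonneg_right ?_ G.h_pos.le)
  have h1 : (1 + c * G.Δ) ^ (G.N - j) ≤ Real.exp (c * T₀) := by
    have h2 : 1 + c * G.Δ ≤ Real.exp (c * G.Δ) := by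
      linarith [Real.add_one_le_exp (c * G.Δ)]
    have h3 : (0 : ℝ) ≤ 1 + c * G.Δ := by
      have := mul_nonneg hc G.Δ_nonneg
      linarith
    refine (pow_le_pow_left₀ h3 h2 _).trans ?_
    rw [← Real.exp_nat_mul, Real.exp_le_exp]
    have h4 := (G.time_le (show G.N - j ≤ G.N by omega)).trans hT
    unfold Mesh.time at h4
    nlinarith
  have : (1 + c + cR) * (1 + c * G.Δ) ^ (G.N - j) ≤ gradBound T₀ c cR :=
    mul_le_mul_of_nonneg_left h1 (by positivity)
  linarith

lemma gradBound_nonneg (hreg : D.Regular T₀ c cB cR) : 0 ≤ gradBound T₀ c cR := by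
  have hc := hreg.c_nonneg
  have hR := hreg.cR_nonneg
  unfold gradBound
  positivity

lemma abs_gradV_le (hreg : D.Regular T₀ c cB cR) (hσ : 0 < D.σ) (hT : T ≤ T₀)
    (hh : G.h * cB ≤ D.σ ^ 2) (hmin : D.IsUniqueMinimizer T₀ αhat) {j : ℕ} (hj : j < G.N) {k : ℤ}
    (hk : k ∈ Icc (0 : ℤ) G.K) : |gradV D G ν j k| ≤ gradBound T₀ c cR :=
  abs_gradV_le_of j hk fun _ hz => abs_Vext_succ_sub_le hreg hσ hT hh hmin hj hz

end Gradient

/-! ### Folding the integers onto the reflected grid. -/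

section Fold

variable {L T σ : ℝ} (G : Mesh L T σ)

/-- The even, periodic folding of `ℤ` onto `{0, …, K}`, by reflection at `-1/2` and `K + 1/2`. -/
def Mesh.fold (x : ℤ) : ℤ :=
  if x % (2 * (G.K + 1)) ≤ G.K then x % (2 * (G.K + 1))
  else 2 * (G.K + 1) - 1 - x % (2 * (G.K + 1))

lemma emod_succ_cases {n : ℤ} (hn : 0 < n) (x : ℤ) :
    ((x + 1) % n = x % n + 1 ∧ x % n + 1 < n) ∨ ((x + 1) % n = 0 ∧ x % n + 1 = n) := by
  have h1 := Int.emod_nonneg x hn.ne'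
  have h2 := Int.emod_lt_of_pos x hn
  have h3 : (x + 1) % n = (x % n + 1) % n := by rw [Int.emod_add_emod]
  rcases (show x % n + 1 < n ∨ x % n + 1 = n by omega) with h | h
  · exact Or.inl ⟨by rw [h3, Int.emod_eq_of_lt (by omega) h], h⟩
  · exact Or.inr ⟨by rw [h3, h, Int.emod_self], h⟩

lemma Mesh.fold_mem (x : ℤ) : G.fold x ∈ Icc (0 : ℤ) G.K := by
  have hn : (0 : ℤ) < 2 * (G.K + 1) := by omega
  have h1 := Int.emod_nonneg x hn.ne'
  have h2 := Int.emod_lt_of_pos x hn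
  unfold Mesh.fold
  rw [mem_Icc]
  split_ifs <;> omega

/-- Folding commutes with passing to reflected neighbours, except that left and right are exchanged
where the folding reverses orientation. Averages are unaffected by this, and differences only change
sign. -/
lemma Mesh.fold_neighbours (x : ℤ) :
    (G.fold (x + 1) = G.reflect (G.fold x + 1) ∧ G.fold (x - 1) = G.reflect (G.fold x - 1)) ∨
    (G.fold (x + 1) = G.reflect (G.fold x - 1) ∧ G.fold (x - 1) = G.reflect (G.fold x + 1)) := by
  have hn : (0 : ℤ) < 2 * (G.K + 1) := by omega
  have h1 := Int.emod_nonneg x hn.ne'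
  have h2 := Int.emod_lt_of_pos x hn
  have h3 := Int.emod_nonneg (x - 1) hn.ne'
  have ha := emod_succ_cases hn x
  have hb := emod_succ_cases hn (x - 1)
  rw [sub_add_cancel] at hb
  unfold Mesh.fold Mesh.reflect
  generalize (x + 1) % (2 * ((G.K : ℤ) + 1)) = a at *
  generalize (x - 1) % (2 * ((G.K : ℤ) + 1)) = b at *
  generalize x % (2 * ((G.K : ℤ) + 1)) = r at *
  by_cases hr : r ≤ G.K
  · left
    rw [if_pos hr]
    constructor <;> split_ifs <;> omega
  · right
    rw [if_neg hr]
    constructor <;> split_ifs <;> omega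

lemma Mesh.fold_eq_reflect {z : ℤ} (hz : z ∈ Icc (-1 : ℤ) (G.K + 1)) :
    G.fold z = G.reflect z := by
  obtain ⟨h1, h2⟩ := hz
  unfold Mesh.fold Mesh.reflect
  rcases eq_or_ne z (-1) with rfl | hz
  · have : (-1 : ℤ) % (2 * (G.K + 1)) = 2 * (G.K + 1) - 1 := by
      rw [← Int.add_emod_right, Int.emod_eq_of_lt] <;> omega
    rw [this, if_pos rfl, if_neg (by omega)]
    ring
  · rw [Int.emod_eq_of_lt (by omega) (by omega)]
    split_ifs <;> omega

/-- A forward difference of a folded function is either zero or, up to sign, a forward difference on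
the grid. Bounds on the grid therefore carry over to `ℤ`. -/
lemma Mesh.fold_succ_cases (x : ℤ) :
    G.fold (x + 1) = G.fold x ∨ G.fold (x + 1) = G.fold x + 1 ∨ G.fold x = G.fold (x + 1) + 1 := by
  have h1 := G.fold_mem x
  rw [mem_Icc] at h1
  rcases G.fold_neighbours x with ⟨h, -⟩ | ⟨h, -⟩ <;> rw [h] <;> unfold Mesh.reflect <;>
    split_ifs <;> omega

end Fold

/-! ### Dependence of the gradient on the measure and on the position. -/

section Smoothing

variable {L T : ℝ} {D : Data L} {G : Mesh L T D.σ} {ν ν' : ProbabilityMeasure (PathSpace T L)}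
  {αhat : ℝ → ProbabilityMeasure (Icc (0 : ℝ) L) → ℝ → ℝ → ℝ} {T₀ c cB cR : ℝ}

lemma add_one_mem {k : ℤ} (hk : k ∈ Icc (0 : ℤ) G.K) : k + 1 ∈ Icc (-1 : ℤ) (G.K + 1) := by
  rw [mem_Icc] at hk ⊢
  omega

lemma sub_one_mem {k : ℤ} (hk : k ∈ Icc (0 : ℤ) G.K) : k - 1 ∈ Icc (-1 : ℤ) (G.K + 1) := by
  rw [mem_Icc] at hk ⊢
  omega

lemma sqrt_steps {n j : ℕ} (h : G.N = j + (n + 1)) : √((n : ℝ) + 1) = √((G.N : ℝ) - j) := by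
  rw [h]
  push_cast
  congr 1
  ring

/-- Averaging over neighbours commutes with folding. -/
lemma heat_fold (φ : ℤ → ℝ) (x : ℤ) :
    heat (fun z => φ (G.fold z)) x
      = (φ (G.reflect (G.fold x + 1)) + φ (G.reflect (G.fold x - 1))) / 2 := by
  simp only [heat]
  rcases G.fold_neighbours x with ⟨h1, h2⟩ | ⟨h1, h2⟩
  · rw [h1, h2]
  · rw [h1, h2, add_comm]

lemma abs_diff_fold (φ : ℤ → ℝ) (x : ℤ) :
    |φ (G.fold (x + 1)) - φ (G.fold (x - 1))|
      = |φ (G.reflect (G.fold x + 1)) - φ (G.reflect (G.fold x - 1))| := by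
  rcases G.fold_neighbours x with ⟨h1, h2⟩ | ⟨h1, h2⟩
  · rw [h1, h2]
  · rw [h1, h2, abs_sub_comm]

/-- The reflection costs do not depend on the flow and cancel. The difference of two value functions
thus satisfies a homogeneous Neumann condition, which is what folding requires. -/
lemma Vext_sub_Vext (j : ℕ) (z : ℤ) :
    Vext D G ν j z - Vext D G ν' j z
      = V D G ν j (G.reflect z) - V D G ν' j (G.reflect z) := by
  have h1 : Vext D G ν j z = extend D G j (V D G ν j) z := rfl
  have h2 : Vext D G ν' j z = extend D G j (V D G ν' j) z := rfl
  rw [h1, h2, extend_eq, extend_eq]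
  ring

lemma gradV_sub_gradV (j : ℕ) (k : ℤ) :
    gradV D G ν j k - gradV D G ν' j k
      = ((V D G ν (j + 1) (G.reflect (k + 1)) - V D G ν' (j + 1) (G.reflect (k + 1)))
        - (V D G ν (j + 1) (G.reflect (k - 1)) - V D G ν' (j + 1) (G.reflect (k - 1))))
        / (2 * G.h) := by
  rw [← Vext_sub_Vext, ← Vext_sub_Vext]
  unfold gradV
  ring

/-- Dependence of the gradient of the value function on the flow of measures. -/
lemma abs_gradV_sub_measure_le (hreg : D.Regular T₀ c cB cR) (hσ : 0 < D.σ) (hT : T ≤ T₀)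
    (hh : G.h * cB ≤ D.σ ^ 2) (hmin : D.IsUniqueMinimizer T₀ αhat)
    (hsmall : 16 * (G.Δ * cB / (2 * G.h)) * √(G.N + 1) ≤ 1) {w : ℝ}
    (hw : ∀ j, W₁ (flow D G ν j) (flow D G ν' j) ≤ w)
    (hw' : ∀ j, W₁ (flow D G ν' j) (flow D G ν j) ≤ w) {j : ℕ} (hj : j < G.N) {k : ℤ}
    (hk : k ∈ Icc (0 : ℤ) G.K) :
    |gradV D G ν j k - gradV D G ν' j k|
      ≤ (4 * (c * w) + 8 * (G.Δ * (c * (1 + gradBound T₀ c cR) * w)) * (G.N + 1))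
        / √((G.N : ℝ) - j) / (2 * G.h) := by
  have hh0 := G.h_pos
  have hΔ := G.Δ_nonneg
  have hc := hreg.c_nonneg
  have hB := hreg.cB_nonneg
  have hP := gradBound_nonneg hreg
  have hw0 : 0 ≤ w := (W₁_nonneg _ _).trans (hw 0)
  set P := gradBound T₀ c cR
  let W : ℕ → ℤ → ℝ := fun n k => V D G ν (G.N - n) k - V D G ν' (G.N - n) k
  let E : ℕ → ℤ → ℝ := fun n k => G.Δ * (ham D G ν αhat (G.N - (n + 1)) k
    (gradV D G ν (G.N - (n + 1)) k) - ham D G ν' αhat (G.N - (n + 1)) k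
    (gradV D G ν' (G.N - (n + 1)) k))
  have hgrad : ∀ n, ∀ k, n < G.N → gradV D G ν (G.N - (n + 1)) k
      - gradV D G ν' (G.N - (n + 1)) k
      = (W n (G.reflect (k + 1)) - W n (G.reflect (k - 1))) / (2 * G.h) := by
    intro n k hn
    rw [gradV_sub_gradV, show G.N - (n + 1) + 1 = G.N - n by omega]
  -- Time is reversed, so `W 0` is the difference of terminal costs. The source satisfies `|E| ≤ Δ
  -- (cB d / (2h) + c (1 + P) w)` whenever `d` bounds the central differences of the folded `W`,
  -- which dictates `β` and `e`.
  have hmain := abs_diff_le_of_heat (u := fun n x => W n (G.fold x))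
    (F := fun n x => E n (G.fold x)) (N := G.N) (M := c * w) (β := G.Δ * cB / (2 * G.h))
    (e := G.Δ * (c * (1 + P) * w)) ?_ ?_ (by positivity) (by positivity) ?_ hsmall
  · obtain ⟨n, hn⟩ : ∃ n, G.N = j + (n + 1) := ⟨G.N - j - 1, by omega⟩
    have h := hmain n (by omega) k
    have h1 := abs_diff_fold (G := G) (W n) k
    rw [G.fold_eq_reflect (z := k) (by rw [mem_Icc] at hk ⊢; omega), G.reflect_of_mem hk] at h1
    have h2 := hgrad n k (by omega)
    rw [show G.N - (n + 1) = j by omega] at h2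
    rw [h2, abs_div, abs_of_pos (show 0 < 2 * G.h by positivity), ← h1, ← sqrt_steps hn]
    exact div_le_div_of_nonneg_right h (by positivity)
  · intro n hn x
    have hx := G.fold_mem x
    rw [heat_fold]
    have h1 : W (n + 1) (G.fold x) = (W n (G.reflect (G.fold x + 1))
        + W n (G.reflect (G.fold x - 1))) / 2 + E n (G.fold x) := by
      simp only [W, E]
      rw [V_recursion hreg hσ hT hh hmin (by omega) hx,
        V_recursion hreg hσ hT hh hmin (by omega) hx, ← Vext_sub_Vext, ← Vext_sub_Vext,
        show G.N - (n + 1) + 1 = G.N - n by omega]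
      ring
    exact h1
  · intro x
    have hx := G.fold_mem x
    simp only [W, Nat.sub_zero]
    rw [V_terminal hreg hσ hT hh hmin hx, V_terminal hreg hσ hT hh hmin hx]
    refine (hreg.g_lip _ _ _ (G.pos_mem hx) _ (G.pos_mem hx)).trans ?_
    rw [sub_self, abs_zero, add_zero]
    exact mul_le_mul_of_nonneg_left (hw _) hc
  · intro n hn d hd x
    have hx := G.fold_mem x
    simp only [E]
    have h1 := abs_ham_sub_le (ν := ν) (ν' := ν') hreg hT hmin (j := G.N - (n + 1)) (by omega)
      hx hx (abs_gradV_le (ν := ν) (j := G.N - (n + 1)) hreg hσ hT hh hmin (by omega) hx)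
      (abs_gradV_le (ν := ν') (j := G.N - (n + 1)) hreg hσ hT hh hmin (by omega) hx) (hw _) (hw' _)
    rw [hgrad n _ hn, abs_div, abs_of_pos (show 0 < 2 * G.h by positivity), sub_self, abs_zero,
      add_zero, ← abs_diff_fold] at h1
    rw [abs_mul, abs_of_nonneg hΔ]
    have h2 : |W n (G.fold (x + 1)) - W n (G.fold (x - 1))| / (2 * G.h) ≤ d / (2 * G.h) :=
      div_le_div_of_nonneg_right (hd x) (by positivity)
    calc _ ≤ G.Δ * (cB * (d / (2 * G.h)) + c * (1 + P) * w) :=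
          mul_le_mul_of_nonneg_left
            (h1.trans (add_le_add_left (mul_le_mul_of_nonneg_left h2 hB) _)) hΔ
      _ = _ := by ring

/-- A quadratic function of the grid point whose slopes at the two ends are prescribed by the
costs of reflection. -/
def slopeCorrector (D : Data L) (G : Mesh L T D.σ) (j : ℕ) (z : ℤ) : ℝ :=
  (D.r (G.time j) + D.y (G.time j)) * G.h / (G.K + 1) * (z * (z + 1) / 2)
    - D.y (G.time j) * G.h * z

/-- The slope interpolates linearly between `-y h` at the edge from `-1` to `0` and `r h` at the
edge from `K` to `K + 1`, which are the slopes of `Vext` there. -/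
lemma slopeCorrector_succ_sub (j : ℕ) (k : ℤ) :
    slopeCorrector D G j (k + 1) - slopeCorrector D G j k
      = G.h * (D.r (G.time j) * ((k + 1) / (G.K + 1))
        - D.y (G.time j) * (1 - (k + 1) / (G.K + 1))) := by
  unfold slopeCorrector
  have : (G.K : ℝ) + 1 ≠ 0 := by positivity
  push_cast
  field_simp
  ring

/-- Being quadratic, the corrector changes under averaging only by a constant in `k`, which
disappears once forward differences are taken. -/
lemma slopeCorrector_avg (j : ℕ) (k : ℤ) :
    (slopeCorrector D G j (k + 1) + slopeCorrector D G j (k - 1)) / 2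
      = slopeCorrector D G j k + (D.r (G.time j) + D.y (G.time j)) * G.h / (G.K + 1) / 2 := by
  unfold slopeCorrector
  push_cast
  ring

lemma slopeCorrector_second_diff (j : ℕ) (k : ℤ) :
    (slopeCorrector D G j (k + 1 + 1) - slopeCorrector D G j (k + 1))
      - (slopeCorrector D G j k - slopeCorrector D G j (k - 1))
      = 2 * ((D.r (G.time j) + D.y (G.time j)) * G.h / (G.K + 1)) := by
  unfold slopeCorrector
  push_cast
  ring

lemma abs_convex_sub_le {a b C θ : ℝ} (ha : |a| ≤ C) (hb : |b| ≤ C) (h0 : 0 ≤ θ) (h1 : θ ≤ 1) :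
    |a * θ - b * (1 - θ)| ≤ C := by
  rw [abs_le] at *
  constructor <;> nlinarith

lemma ratio_mem {k : ℤ} (hk : k ∈ Icc (-1 : ℤ) G.K) :
    0 ≤ ((k : ℝ) + 1) / (G.K + 1) ∧ ((k : ℝ) + 1) / (G.K + 1) ≤ 1 := by
  have h1 : (0 : ℝ) ≤ k + 1 := by
    have := hk.1
    exact_mod_cast (show (0 : ℤ) ≤ k + 1 by omega)
  have h2 : (k : ℝ) ≤ G.K := by exact_mod_cast hk.2
  refine ⟨by positivity, ?_⟩
  rw [div_le_one (by positivity)]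
  linarith

/-- The value function with its boundary slopes removed. -/
def flatV (D : Data L) (G : Mesh L T D.σ) (ν : ProbabilityMeasure (PathSpace T L)) (j : ℕ)
    (z : ℤ) : ℝ :=
  Vext D G ν j z - slopeCorrector D G j z

/-- The corrector carries the boundary slopes of `Vext`, so the remainder has slope zero across both
edges and can be folded. -/
lemma flatV_reflect (j : ℕ) (z : ℤ) : flatV D G ν j (G.reflect z) = flatV D G ν j z := by
  unfold flatV
  rcases eq_or_ne z (-1) with rfl | h1
  · rw [show G.reflect (-1) = 0 by simp [Mesh.reflect], Vext_neg_one,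
      Vext_of_mem _ (by simp)]
    unfold slopeCorrector
    push_cast
    ring
  rcases eq_or_ne z (G.K + 1) with rfl | h2
  · have hr : G.reflect (G.K + 1) = G.K := by
      unfold Mesh.reflect
      rw [if_neg (by omega), if_pos rfl]
    rw [hr, Vext_succ_K, Vext_of_mem _ (by simp)]
    have h := slopeCorrector_succ_sub (D := D) (G := G) j G.K
    have hK : (G.K : ℝ) + 1 ≠ 0 := by positivity
    push_cast at h
    rw [div_self hK] at h
    linarith
  · rw [show G.reflect z = z by simp [Mesh.reflect, h1, h2]]

lemma Vext_succ_sub_eq (j : ℕ) (z : ℤ) :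
    Vext D G ν j (z + 1) - Vext D G ν j z = (flatV D G ν j (z + 1) - flatV D G ν j z)
      + (slopeCorrector D G j (z + 1) - slopeCorrector D G j z) := by
  unfold flatV
  ring

/-- The gradient of the value function is Lipschitz in space, with a constant that is singular at
the terminal time. -/
lemma abs_gradV_succ_sub_le (hreg : D.Regular T₀ c cB cR) (hL : 0 < L) (hσ : 0 < D.σ)
    (hT : T ≤ T₀) (hh : G.h * cB ≤ D.σ ^ 2) (hmin : D.IsUniqueMinimizer T₀ αhat)
    (hsmall : 16 * (G.Δ * cB / (2 * G.h)) * √(G.N + 1) ≤ 1) {j : ℕ} (hj : j < G.N) {k : ℤ}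
    (hk : k ∈ Icc (0 : ℤ) G.K) (hk' : k + 1 ∈ Icc (0 : ℤ) G.K) :
    |gradV D G ν j (k + 1) - gradV D G ν j k|
      ≤ (4 * ((gradBound T₀ c cR + cR) * G.h)
          + 8 * (G.Δ * G.h * (cB * (2 * cR / L) + c * (1 + gradBound T₀ c cR) + c)) * (G.N + 1))
        / √((G.N : ℝ) - j) / (2 * G.h) + 2 * cR / L * G.h := by
  have hh0 := G.h_pos
  have hΔ := G.Δ_nonneg
  have hc := hreg.c_nonneg
  have hB := hreg.cB_nonneg
  have hR := hreg.cR_nonneg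
  have hP := gradBound_nonneg hreg
  set P := gradBound T₀ c cR
  let A : ℕ → ℝ := fun n => (D.r (G.time n) + D.y (G.time n)) * G.h / (G.K + 1)
  let U : ℕ → ℤ → ℝ := fun n x => flatV D G ν (G.N - n) (G.fold x)
  let E : ℕ → ℤ → ℝ := fun n k => G.Δ * ham D G ν αhat (G.N - (n + 1)) k
    (gradV D G ν (G.N - (n + 1)) k) + A (G.N - n) / 2 + slopeCorrector D G (G.N - n) k
    - slopeCorrector D G (G.N - (n + 1)) k
  have hUrec : ∀ n < G.N, ∀ x, U (n + 1) x = heat (U n) x + E n (G.fold x) := by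
    intro n hn x
    have hx := G.fold_mem x
    have h0 : heat (U n) x = _ := heat_fold (G := G) (flatV D G ν (G.N - n)) x
    rw [h0, flatV_reflect, flatV_reflect]
    simp only [U, E, A]
    have h1 := slopeCorrector_avg (D := D) (G := G) (G.N - n) (G.fold x)
    have h2 := V_recursion (ν := ν) hreg hσ hT hh hmin (j := G.N - (n + 1)) (by omega) hx
    rw [show G.N - (n + 1) + 1 = G.N - n by omega] at h2
    unfold flatV
    rw [Vext_of_mem _ hx]
    linear_combination h2 + h1
  have hgrad : ∀ n < G.N, ∀ k ∈ Icc (0 : ℤ) G.K, k + 1 ∈ Icc (0 : ℤ) G.K →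
      gradV D G ν (G.N - (n + 1)) (k + 1) - gradV D G ν (G.N - (n + 1)) k
        = ((U n (k + 1 + 1) - U n (k + 1)) - (U n (k - 1 + 1) - U n (k - 1))) / (2 * G.h)
          + A (G.N - n) / G.h := by
    intro n hn k hk hk'
    have hU : ∀ z ∈ Icc (-1 : ℤ) (G.K + 1), U n z = flatV D G ν (G.N - n) z := by
      intro z hz
      simp only [U]
      rw [G.fold_eq_reflect hz, flatV_reflect]
    rw [hU _ (add_one_mem hk'), hU _ (add_one_mem hk), sub_add_cancel, hU _ (sub_one_mem hk),
      hU k (by rw [mem_Icc] at hk ⊢; omega), gradV_succ_sub,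
      show G.N - (n + 1) + 1 = G.N - n by omega]
    have h1 := slopeCorrector_second_diff (D := D) (G := G) (G.N - n) k
    have h2 : A (G.N - n) / G.h = 2 * A (G.N - n) / (2 * G.h) := by field_simp
    rw [h2, ← add_div]
    congr 1
    simp only [A, flatV]
    linear_combination h1
  have hA : ∀ n ≤ G.N, |A n / G.h| ≤ 2 * cR / L * G.h := by
    intro n hn
    have ht := G.time_mem hT hn
    simp only [A]
    have e : (D.r (G.time n) + D.y (G.time n)) * G.h / (G.K + 1) / G.h
        = (D.r (G.time n) + D.y (G.time n)) / (G.K + 1) := by field_simp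
    have hK : (0 : ℝ) < G.K + 1 := by positivity
    rw [e, abs_div, abs_of_pos hK, div_le_iff₀ hK]
    have h1 : |D.r (G.time n) + D.y (G.time n)| ≤ 2 * cR :=
      (abs_add_le _ _).trans (by linarith [hreg.r_bound _ ht, hreg.y_bound _ ht])
    have h2 : L ≤ G.h * (G.K + 1) := by
      have := G.K_mul_h
      linarith
    calc _ ≤ 2 * cR := h1
      _ = 2 * cR / L * L := by field_simp
      _ ≤ 2 * cR / L * (G.h * (G.K + 1)) := mul_le_mul_of_nonneg_left h2 (by positivity)
      _ = _ := by ring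
  have hgradle : ∀ n < G.N, ∀ d, (∀ x, |(U n (x + 1 + 1) - U n (x + 1))
      - (U n (x - 1 + 1) - U n (x - 1))| ≤ d) → ∀ k ∈ Icc (0 : ℤ) G.K, k + 1 ∈ Icc (0 : ℤ) G.K →
      |gradV D G ν (G.N - (n + 1)) (k + 1) - gradV D G ν (G.N - (n + 1)) k|
        ≤ d / (2 * G.h) + 2 * cR / L * G.h := by
    intro n hn d hd k hk hk'
    rw [hgrad n hn k hk hk']
    refine (abs_add_le _ _).trans (add_le_add ?_ (hA _ (by omega)))
    rw [abs_div, abs_of_pos (show 0 < 2 * G.h by positivity)]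
    exact div_le_div_of_nonneg_right (hd k) (by positivity)
  -- The smoothing estimate is applied one derivative higher: central differences of the forward
  -- differences of `U` are increments of `gradV`, up to the corrector. The initial bound `M` adds
  -- the slopes of the value function and of the corrector. In `e`, the term with `2 * cR / L` comes
  -- from the second difference of the corrector, the last `c` from the time variation of `y` and
  -- `r`.
  have hmain := abs_diff_le_of_heat (u := fun n x => U n (x + 1) - U n x)
    (F := fun n x => E n (G.fold (x + 1)) - E n (G.fold x)) (N := G.N) (M := (P + cR) * G.h)
    (β := G.Δ * cB / (2 * G.h)) (e := G.Δ * G.h * (cB * (2 * cR / L) + c * (1 + P) + c))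
    ?_ ?_ (by positivity) (by positivity) ?_ hsmall
  · obtain ⟨n, hn⟩ : ∃ n, G.N = j + (n + 1) := ⟨G.N - j - 1, by omega⟩
    have h := hgradle n (by omega) _ (hmain n (by omega)) k hk hk'
    rw [show G.N - (n + 1) = j by omega, sqrt_steps hn] at h
    exact h
  · intro n hn x
    have h1 := hUrec n hn x
    have h2 := hUrec n hn (x + 1)
    simp only [heat] at h1 h2 ⊢
    rw [h1, h2, add_sub_cancel_right, sub_add_cancel]
    ring
  · intro x
    have hbound : ∀ k ∈ Icc (0 : ℤ) G.K, k + 1 ∈ Icc (0 : ℤ) G.K →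
        |flatV D G ν G.N (k + 1) - flatV D G ν G.N k| ≤ (P + cR) * G.h := by
      intro k hk hk'
      have hz : k ∈ Icc (-1 : ℤ) G.K := by rw [mem_Icc] at hk ⊢; omega
      have ht := G.time_mem hT le_rfl
      have h1 := Vext_succ_sub_eq (ν := ν) (D := D) (G := G) G.N k
      have h2 := abs_Vext_succ_sub_le (ν := ν) hreg hσ hT hh hmin le_rfl hz
      have h3 := abs_convex_sub_le (hreg.r_bound _ ht) (hreg.y_bound _ ht) (ratio_mem hz).1
        (ratio_mem hz).2
      rw [slopeCorrector_succ_sub] at h1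
      rw [eq_sub_of_add_eq h1.symm]
      refine (abs_sub _ _).trans ?_
      rw [abs_mul, abs_of_pos hh0]
      have := mul_le_mul_of_nonneg_left h3 hh0.le
      linarith
    simp only [U, Nat.sub_zero]
    have ha := G.fold_mem x
    have hb := G.fold_mem (x + 1)
    rcases G.fold_succ_cases x with h | h | h
    · rw [h, sub_self, abs_zero]
      positivity
    · rw [h] at hb ⊢
      exact hbound _ ha hb
    · rw [h] at ha ⊢
      rw [abs_sub_comm]
      exact hbound _ hb ha
  · intro n hn d hd x
    have hd0 : 0 ≤ d := (abs_nonneg _).trans (hd 0)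
    have hbound : ∀ k ∈ Icc (0 : ℤ) G.K, k + 1 ∈ Icc (0 : ℤ) G.K →
        |E n (k + 1) - E n k| ≤ G.Δ * cB / (2 * G.h) * d
          + G.Δ * G.h * (cB * (2 * cR / L) + c * (1 + P) + c) := by
      intro k hk hk'
      have hz : k ∈ Icc (-1 : ℤ) G.K := by rw [mem_Icc] at hk ⊢; omega
      have ht := G.time_mem hT (show G.N - n ≤ G.N by omega)
      have ht' := G.time_mem hT (show G.N - (n + 1) ≤ G.N by omega)
      have hdt : |G.time (G.N - n) - G.time (G.N - (n + 1))| = G.Δ := by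
        rw [show G.N - n = G.N - (n + 1) + 1 by omega]
        unfold Mesh.time
        push_cast
        rw [← sub_mul, add_sub_cancel_left, one_mul, abs_of_nonneg hΔ]
      have h1 := abs_ham_sub_le (ν := ν) (ν' := ν) hreg hT hmin (j := G.N - (n + 1)) (by omega)
        hk' hk (abs_gradV_le (ν := ν) (j := G.N - (n + 1)) hreg hσ hT hh hmin (by omega) hk')
        (abs_gradV_le (ν := ν) (j := G.N - (n + 1)) hreg hσ hT hh hmin (by omega) hk) (w := 0) (W₁_self _).le (W₁_self _).le
      rw [pos_succ_sub, abs_of_pos hh0, zero_add] at h1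
      have h2 := hgradle n hn d hd k hk hk'
      have hr := hreg.r_lip _ ht _ ht'
      have hy := hreg.y_lip _ ht _ ht'
      rw [hdt] at hr hy
      have h3 := abs_convex_sub_le hr hy (ratio_mem hz).1 (ratio_mem hz).2
      -- The constant from averaging the corrector cancels; what remains of the corrector is its
      -- change over one time step, of size `h c Δ`.
      have e : E n (k + 1) - E n k = G.Δ * (ham D G ν αhat (G.N - (n + 1)) (k + 1)
            (gradV D G ν (G.N - (n + 1)) (k + 1)) - ham D G ν αhat (G.N - (n + 1)) k
            (gradV D G ν (G.N - (n + 1)) k))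
          + G.h * ((D.r (G.time (G.N - n)) - D.r (G.time (G.N - (n + 1))))
              * ((k + 1) / (G.K + 1))
            - (D.y (G.time (G.N - n)) - D.y (G.time (G.N - (n + 1))))
              * (1 - (k + 1) / (G.K + 1))) := by
        simp only [E]
        have e1 := slopeCorrector_succ_sub (D := D) (G := G) (G.N - n) k
        have e2 := slopeCorrector_succ_sub (D := D) (G := G) (G.N - (n + 1)) k
        linear_combination e1 - e2
      rw [e]
      refine (abs_add_le _ _).trans ?_
      rw [abs_mul, abs_mul, abs_of_nonneg hΔ, abs_of_pos hh0]
      calc _ ≤ G.Δ * (cB * (d / (2 * G.h) + 2 * cR / L * G.h) + c * (1 + P) * G.h)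
            + G.h * (c * G.Δ) :=
            add_le_add (mul_le_mul_of_nonneg_left
              (h1.trans (add_le_add_left (mul_le_mul_of_nonneg_left h2 hB) _)) hΔ)
              (mul_le_mul_of_nonneg_left h3 hh0.le)
        _ = _ := by ring
    have ha := G.fold_mem x
    have hb := G.fold_mem (x + 1)
    rcases G.fold_succ_cases x with h | h | h
    · simp only [h, sub_self, abs_zero]
      positivity
    · simp only [h] at hb ⊢
      exact hbound _ ha hb
    · simp only [h] at ha ⊢
      rw [abs_sub_comm]
      exact hbound _ hb ha

end Smoothing

/-! ### Constants independent of the mesh. -/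

/-- Each increment is bounded by the whole sum in the Lipschitz condition. The domain has finite
diameter, as `W₁ ≤ L` and `U` is bounded, so comparison with one reference point bounds the drift.
Nonemptiness of `U` supplies the control needed to read off `g`, `y` and `r`. -/
lemma Data.IsLipschitz.exists_regular {L T₀ : ℝ} (hL : 0 < L) (hT₀ : 0 < T₀) {D : Data L}
    (hU : IsCompact D.U) (hne : D.U.Nonempty) (hD : D.IsLipschitz T₀) :
    ∃ c cB cR, D.Regular T₀ c cB cR := by
  obtain ⟨c, hc, h⟩ := hD
  obtain ⟨u₀, hu₀⟩ := hne
  obtain ⟨R, hR⟩ := hU.isBounded.exists_norm_le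
  have h0 : (0 : ℝ) ∈ Icc 0 T₀ := ⟨le_rfl, hT₀.le⟩
  have hx0 : (0 : ℝ) ∈ Icc 0 L := ⟨le_rfl, hL.le⟩
  let η₀ : ProbabilityMeasure (Icc (0 : ℝ) L) := ⟨Measure.dirac ⟨0, hx0⟩, inferInstance⟩
  have hR0 : 0 ≤ R := (norm_nonneg _).trans (hR u₀ hu₀)
  have hy : ∀ t ∈ Icc 0 T₀, ∀ t' ∈ Icc 0 T₀, |D.y t - D.y t'| ≤ c * |t - t'| := by
    intro t ht t' ht'
    have := h t ht t' ht' η₀ η₀ 0 hx0 0 hx0 u₀ hu₀ u₀ hu₀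
    simp only [W₁_self, sub_self, abs_zero, add_zero] at this
    linarith [abs_nonneg (D.f t η₀ 0 u₀ - D.f t' η₀ 0 u₀),
      abs_nonneg (D.b t η₀ 0 u₀ - D.b t' η₀ 0 u₀), abs_nonneg (D.r t - D.r t')]
  have hr : ∀ t ∈ Icc 0 T₀, ∀ t' ∈ Icc 0 T₀, |D.r t - D.r t'| ≤ c * |t - t'| := by
    intro t ht t' ht'
    have := h t ht t' ht' η₀ η₀ 0 hx0 0 hx0 u₀ hu₀ u₀ hu₀
    simp only [W₁_self, sub_self, abs_zero, add_zero] at this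
    linarith [abs_nonneg (D.f t η₀ 0 u₀ - D.f t' η₀ 0 u₀),
      abs_nonneg (D.b t η₀ 0 u₀ - D.b t' η₀ 0 u₀), abs_nonneg (D.y t - D.y t')]
  have bound : ∀ φ : ℝ → ℝ, (∀ t ∈ Icc 0 T₀, ∀ t' ∈ Icc 0 T₀, |φ t - φ t'| ≤ c * |t - t'|) →
      ∀ t ∈ Icc 0 T₀, |φ t| ≤ |φ 0| + c * T₀ := by
    intro φ hφ t ht
    have h1 := hφ t ht 0 h0
    rw [sub_zero, abs_of_nonneg ht.1] at h1
    have h2 := abs_sub_abs_le_abs_sub (φ t) (φ 0)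
    have h3 := mul_le_mul_of_nonneg_left ht.2 hc.le
    linarith
  refine ⟨c, |D.b 0 η₀ 0 u₀| + c * (T₀ + L + L + (R + R)), |D.y 0| + |D.r 0| + c * T₀,
    { c_nonneg := hc.le
      cB_nonneg := by positivity
      cR_nonneg := by positivity
      f_lip := ?_
      b_lip := ?_
      g_lip := ?_
      y_lip := hy
      r_lip := hr
      b_bound := ?_
      y_bound := ?_
      r_bound := ?_ }⟩
  · intro t ht η η' x hx x' hx' u hu
    have := h t ht t ht η η' x hx x' hx' u hu u hu
    simp only [sub_self, abs_zero, add_zero, zero_add] at this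
    linarith [abs_nonneg (D.g η x - D.g η' x'), abs_nonneg (D.b t η x u - D.b t η' x' u)]
  · intro t ht η η' x hx x' hx' u hu u' hu'
    have := h t ht t ht η η' x hx x' hx' u hu u' hu'
    simp only [sub_self, abs_zero, add_zero, zero_add] at this
    linarith [abs_nonneg (D.g η x - D.g η' x'), abs_nonneg (D.f t η x u - D.f t η' x' u')]
  · intro η η' x hx x' hx'
    have := h 0 h0 0 h0 η η' x hx x' hx' u₀ hu₀ u₀ hu₀
    simp only [sub_self, abs_zero, add_zero, zero_add] at this
    linarith [abs_nonneg (D.f 0 η x u₀ - D.f 0 η' x' u₀),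
      abs_nonneg (D.b 0 η x u₀ - D.b 0 η' x' u₀)]
  · intro t ht η x hx u hu
    have h1 := h t ht 0 h0 η η₀ x hx 0 hx0 u hu u₀ hu₀
    have h2 : |D.b t η x u - D.b 0 η₀ 0 u₀| ≤ c * (|t - 0| + W₁ η η₀ + |x - 0| + |u - u₀|) := by
      linarith [abs_nonneg (D.f t η x u - D.f 0 η₀ 0 u₀), abs_nonneg (D.g η x - D.g η₀ 0),
        abs_nonneg (D.y t - D.y 0), abs_nonneg (D.r t - D.r 0)]
    have h3 := abs_sub_abs_le_abs_sub (D.b t η x u) (D.b 0 η₀ 0 u₀)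
    have h4 : |t - 0| + W₁ η η₀ + |x - 0| + |u - u₀| ≤ T₀ + L + L + (R + R) := by
      have a1 : |t - 0| ≤ T₀ := by rw [sub_zero, abs_of_nonneg ht.1]; exact ht.2
      have a2 : |x - 0| ≤ L := by rw [sub_zero, abs_of_nonneg hx.1]; exact hx.2
      have a3 : |u - u₀| ≤ R + R :=
        (abs_sub _ _).trans (add_le_add (hR u hu) (hR u₀ hu₀))
      have a4 := W₁_le_of_dist_le (dist_Icc_le (L := L)) η η₀
      linarith
    have h5 := mul_le_mul_of_nonneg_left h4 hc.le
    linarith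
  · intro t ht
    linarith [bound D.y hy t ht, abs_nonneg (D.r 0)]
  · intro t ht
    linarith [bound D.r hr t ht, abs_nonneg (D.y 0)]

/-- The constant in the dependence of the gradient on the flow of measures. -/
def gradMeasureConst (T₀ c cR : ℝ) : ℝ := 2 * c + 8 * T₀ * (c * (1 + gradBound T₀ c cR))

/-- The constant in the dependence of the gradient on the position. -/
def gradSpaceConst (L σ T₀ c cB cR : ℝ) : ℝ :=
  2 * (gradBound T₀ c cR + cR)
    + 8 * T₀ * (cB * (2 * cR / L) + c * (1 + gradBound T₀ c cR) + c)
    + 2 * cR / L * (σ * √T₀)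

section Combined

variable {L T : ℝ} {D : Data L} {G : Mesh L T D.σ} {ν ν' : ProbabilityMeasure (PathSpace T L)}
  {αhat : ℝ → ProbabilityMeasure (Icc (0 : ℝ) L) → ℝ → ℝ → ℝ} {T₀ c cB cR : ℝ}

/-- Parabolic scaling: from `N Δ = T` and `h² = Δ σ²`. It is how step counts become times, and hence
how the smallness of `T` enters. -/
lemma h_mul_sqrt_N (hσ : 0 < D.σ) : G.h * √G.N = D.σ * √T := by
  have h1 : G.h * √G.N = √(G.h ^ 2 * G.N) := by
    rw [Real.sqrt_mul (sq_nonneg _), Real.sqrt_sq G.h_pos.le]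
  have h2 : D.σ * √T = √(D.σ ^ 2 * T) := by
    rw [Real.sqrt_mul (sq_nonneg _), Real.sqrt_sq hσ.le]
  have h3 : G.N * G.Δ = T := G.N_mul_Δ
  rw [h1, h2, G.h_sq hσ]
  congr 1
  linear_combination D.σ ^ 2 * h3

lemma one_le_N (hT : 0 < T) : 1 ≤ G.N := by
  rw [Nat.one_le_iff_ne_zero]
  intro h
  have := G.N_mul_Δ
  rw [h, Nat.cast_zero, zero_mul] at this
  exact hT.ne this

lemma Δ_mul_le (hT : 0 < T) (hT₀ : T ≤ T₀) : G.Δ * (G.N + 1) ≤ 2 * T₀ := by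
  have h1 : (1 : ℝ) ≤ G.N := by exact_mod_cast one_le_N hT
  have h2 : G.N * G.Δ = T := G.N_mul_Δ
  have h3 := mul_le_mul_of_nonneg_right h1 G.Δ_nonneg
  linarith

lemma sqrt_steps_pos {j : ℕ} (hj : j < G.N) : 0 < √((G.N : ℝ) - j) :=
  Real.sqrt_pos.2 (sub_pos.2 (by exact_mod_cast hj))

/-- Lets bounded terms be absorbed into singular ones of order `1 / (h √(N - j))`, at the price of
the factor `σ √T₀`. -/
lemma h_mul_sqrt_steps_le (hσ : 0 < D.σ) (hT₀ : T ≤ T₀) (j : ℕ) :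
    G.h * √((G.N : ℝ) - j) ≤ D.σ * √T₀ := by
  have h1 : √((G.N : ℝ) - j) ≤ √G.N := Real.sqrt_le_sqrt (by simp)
  calc _ ≤ G.h * √G.N := mul_le_mul_of_nonneg_left h1 G.h_pos.le
    _ = D.σ * √T := h_mul_sqrt_N hσ
    _ ≤ _ := mul_le_mul_of_nonneg_left (Real.sqrt_le_sqrt hT₀) hσ.le

lemma abs_gradV_sub_measure_le_const (hreg : D.Regular T₀ c cB cR) (hσ : 0 < D.σ) (hT : 0 < T)
    (hT₀ : T ≤ T₀) (hh : G.h * cB ≤ D.σ ^ 2) (hmin : D.IsUniqueMinimizer T₀ αhat)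
    (hsmall : 16 * (G.Δ * cB / (2 * G.h)) * √(G.N + 1) ≤ 1) {w : ℝ}
    (hw : ∀ j, W₁ (flow D G ν j) (flow D G ν' j) ≤ w)
    (hw' : ∀ j, W₁ (flow D G ν' j) (flow D G ν j) ≤ w) {j : ℕ} (hj : j < G.N) {k : ℤ}
    (hk : k ∈ Icc (0 : ℤ) G.K) :
    |gradV D G ν j k - gradV D G ν' j k|
      ≤ gradMeasureConst T₀ c cR * w / (G.h * √((G.N : ℝ) - j)) := by
  refine (abs_gradV_sub_measure_le hreg hσ hT₀ hh hmin hsmall hw hw' hj hk).trans ?_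
  have hs := sqrt_steps_pos hj
  have hc := hreg.c_nonneg
  have hP := gradBound_nonneg hreg
  have hw0 : 0 ≤ w := (W₁_nonneg _ _).trans (hw 0)
  have hh0 := G.h_pos
  have h1 := mul_le_mul_of_nonneg_right (Δ_mul_le (G := G) hT hT₀)
    (show 0 ≤ c * (1 + gradBound T₀ c cR) * w by positivity)
  rw [div_div, div_le_div_iff₀ (by positivity) (by positivity)]
  have h2 : 4 * (c * w) + 8 * (G.Δ * (c * (1 + gradBound T₀ c cR) * w)) * (G.N + 1)
      ≤ 2 * (gradMeasureConst T₀ c cR * w) := by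
    unfold gradMeasureConst
    linarith
  calc _ ≤ 2 * (gradMeasureConst T₀ c cR * w) * (G.h * √((G.N : ℝ) - j)) :=
        mul_le_mul_of_nonneg_right h2 (by positivity)
    _ = _ := by ring

lemma abs_gradV_succ_sub_le_const (hreg : D.Regular T₀ c cB cR) (hL : 0 < L) (hσ : 0 < D.σ)
    (hT : 0 < T) (hT₀ : T ≤ T₀) (hh : G.h * cB ≤ D.σ ^ 2) (hmin : D.IsUniqueMinimizer T₀ αhat)
    (hsmall : 16 * (G.Δ * cB / (2 * G.h)) * √(G.N + 1) ≤ 1) {j : ℕ} (hj : j < G.N) {k : ℤ}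
    (hk : k ∈ Icc (0 : ℤ) G.K) (hk' : k + 1 ∈ Icc (0 : ℤ) G.K) :
    |gradV D G ν j (k + 1) - gradV D G ν j k|
      ≤ gradSpaceConst L D.σ T₀ c cB cR / √((G.N : ℝ) - j) := by
  refine (abs_gradV_succ_sub_le hreg hL hσ hT₀ hh hmin hsmall hj hk hk').trans ?_
  have hs := sqrt_steps_pos hj
  have hc := hreg.c_nonneg
  have hB := hreg.cB_nonneg
  have hR := hreg.cR_nonneg
  have hP := gradBound_nonneg hreg
  have hh0 := G.h_pos
  set P := gradBound T₀ c cR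
  set Q := cB * (2 * cR / L) + c * (1 + P) + c
  have hQ : 0 ≤ Q := by positivity
  have h1 := mul_le_mul_of_nonneg_right (Δ_mul_le (G := G) hT hT₀) hQ
  have h2 := mul_le_mul_of_nonneg_left (h_mul_sqrt_steps_le (G := G) hσ hT₀ j)
    (show 0 ≤ 2 * cR / L by positivity)
  rw [le_div_iff₀ hs]
  have e : ((4 * ((P + cR) * G.h) + 8 * (G.Δ * G.h * Q) * (G.N + 1)) / √((G.N : ℝ) - j)
        / (2 * G.h) + 2 * cR / L * G.h) * √((G.N : ℝ) - j)
      = 2 * (P + cR) + 4 * (G.Δ * (G.N + 1) * Q)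
        + 2 * cR / L * (G.h * √((G.N : ℝ) - j)) := by
    field_simp
    ring
  rw [e]
  unfold gradSpaceConst
  linarith

lemma abs_sub_le_of_succ {φ : ℤ → ℝ} {K : ℕ} {C : ℝ}
    (h : ∀ k ∈ Icc (0 : ℤ) K, k + 1 ∈ Icc (0 : ℤ) K → |φ (k + 1) - φ k| ≤ C) {k k' : ℤ}
    (hk : k ∈ Icc (0 : ℤ) K) (hk' : k' ∈ Icc (0 : ℤ) K) : |φ k - φ k'| ≤ C * |(k : ℝ) - k'| := by
  have key : ∀ n : ℕ, ∀ k ∈ Icc (0 : ℤ) K, k + n ∈ Icc (0 : ℤ) K →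
      |φ (k + n) - φ k| ≤ C * n := by
    intro n
    induction n with
    | zero => simp
    | succ n ih =>
      intro k hk hkn
      rw [mem_Icc] at hk hkn
      push_cast at hkn ⊢
      have h1 := ih k (by rw [mem_Icc]; omega) (by rw [mem_Icc]; omega)
      have h2 := h (k + n) (by rw [mem_Icc]; omega) (by rw [mem_Icc]; omega)
      rw [add_assoc] at h2
      have h3 := abs_sub_le (φ (k + (n + 1))) (φ (k + n)) (φ k)
      linarith
  rcases le_total k' k with hle | hle
  · obtain ⟨n, rfl⟩ := Int.le.dest hle
    have := key n k' hk' hk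
    push_cast
    rwa [add_sub_cancel_left, abs_of_nonneg (Nat.cast_nonneg n : (0 : ℝ) ≤ n)]
  · obtain ⟨n, rfl⟩ := Int.le.dest hle
    have := key n k hk hk'
    push_cast
    rwa [abs_sub_comm, sub_add_cancel_left, abs_neg, abs_of_nonneg (Nat.cast_nonneg n : (0 : ℝ) ≤ n)]

lemma gradMeasureConst_nonneg (hreg : D.Regular T₀ c cB cR) (hT₀ : 0 ≤ T₀) :
    0 ≤ gradMeasureConst T₀ c cR := by
  have hc := hreg.c_nonneg
  have hP := gradBound_nonneg hreg
  unfold gradMeasureConst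
  positivity

lemma gradSpaceConst_nonneg (hreg : D.Regular T₀ c cB cR) (hL : 0 < L) (hσ : 0 < D.σ)
    (hT₀ : 0 ≤ T₀) : 0 ≤ gradSpaceConst L D.σ T₀ c cB cR := by
  have hc := hreg.c_nonneg
  have hB := hreg.cB_nonneg
  have hR := hreg.cR_nonneg
  have hP := gradBound_nonneg hreg
  unfold gradSpaceConst
  positivity

/-- Joint dependence of the gradient of the value function on the position and the flow. -/
lemma abs_gradV_sub_le (hreg : D.Regular T₀ c cB cR) (hL : 0 < L) (hσ : 0 < D.σ)
    (hT : 0 < T) (hT₀ : T ≤ T₀) (hh : G.h * cB ≤ D.σ ^ 2) (hmin : D.IsUniqueMinimizer T₀ αhat)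
    (hsmall : 16 * (G.Δ * cB / (2 * G.h)) * √(G.N + 1) ≤ 1) {w : ℝ}
    (hw : ∀ j, W₁ (flow D G ν j) (flow D G ν' j) ≤ w)
    (hw' : ∀ j, W₁ (flow D G ν' j) (flow D G ν j) ≤ w) {j : ℕ} (hj : j < G.N) {k k' : ℤ}
    (hk : k ∈ Icc (0 : ℤ) G.K) (hk' : k' ∈ Icc (0 : ℤ) G.K) :
    |gradV D G ν j k - gradV D G ν' j k'|
      ≤ (gradSpaceConst L D.σ T₀ c cB cR + gradMeasureConst T₀ c cR)
        * (w + |G.pos k - G.pos k'|) / (G.h * √((G.N : ℝ) - j)) := by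
  have hs := sqrt_steps_pos hj
  have hh0 := G.h_pos
  have hw0 : 0 ≤ w := (W₁_nonneg _ _).trans (hw 0)
  have hA1 := gradMeasureConst_nonneg hreg (hT.le.trans hT₀)
  have hA2 := gradSpaceConst_nonneg hreg hL hσ (hT.le.trans hT₀)
  have h1 := abs_sub_le_of_succ (φ := gradV D G ν j) (fun k hk hk' =>
    abs_gradV_succ_sub_le_const hreg hL hσ hT hT₀ hh hmin hsmall hj hk hk') hk hk'
  have h2 := abs_gradV_sub_measure_le_const hreg hσ hT hT₀ hh hmin hsmall hw hw' hj hk'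
  have e : |G.pos k - G.pos k'| = G.h * |(k : ℝ) - k'| := by
    unfold Mesh.pos
    rw [← sub_mul, abs_mul, abs_of_pos hh0, mul_comm]
  refine (abs_sub_le _ (gradV D G ν j k') _).trans ((add_le_add h1 h2).trans ?_)
  rw [e]
  set A1 := gradMeasureConst T₀ c cR
  set A2 := gradSpaceConst L D.σ T₀ c cB cR
  set s := √((G.N : ℝ) - j)
  have e2 : A2 / s * |(k : ℝ) - k'| + A1 * w / (G.h * s)
      = (A2 * (G.h * |(k : ℝ) - k'|) + A1 * w) / (G.h * s) := by
    field_simp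
  rw [e2]
  refine div_le_div_of_nonneg_right ?_ (by positivity)
  have a1 : 0 ≤ A2 * w := by positivity
  have a2 : 0 ≤ A1 * (G.h * |(k : ℝ) - k'|) := by positivity
  linarith

end Combined

/-! ### Coupling the two chains. -/

/-- The coupling of two coins that agree as often as possible. -/
def coinPair (p q : Icc (0 : ℝ) 1) : PMF (Bool × Bool) :=
  PMF.ofFintype (fun z => ENNReal.ofReal
    (if z.1 then (if z.2 then min (p : ℝ) q else p - min (p : ℝ) q)
      else (if z.2 then q - min (p : ℝ) q else 1 - max (p : ℝ) q))) (by
    have hp := p.2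
    have hq := q.2
    have h1 : 0 ≤ min (p : ℝ) q := le_min hp.1 hq.1
    have h2 : 0 ≤ p - min (p : ℝ) q := sub_nonneg.2 (min_le_left _ _)
    have h3 : 0 ≤ q - min (p : ℝ) q := sub_nonneg.2 (min_le_right _ _)
    have h4 : 0 ≤ 1 - max (p : ℝ) q := sub_nonneg.2 (max_le hp.2 hq.2)
    simp only [Fintype.sum_prod_type, Fintype.sum_bool, if_true, Bool.false_eq_true, if_false]
    rw [← ENNReal.ofReal_add h1 h2, ← ENNReal.ofReal_add h3 h4,
      ← ENNReal.ofReal_add (by linarith) (by linarith), ← ENNReal.ofReal_one]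
    congr 1
    linarith [min_add_max (p : ℝ) q])

lemma coinPair_map_fst (p q : Icc (0 : ℝ) 1) : (coinPair p q).map Prod.fst = coin p := by
  have hp := p.2
  have hq := q.2
  have h1 : 0 ≤ min (p : ℝ) q := le_min hp.1 hq.1
  have h2 : 0 ≤ p - min (p : ℝ) q := sub_nonneg.2 (min_le_left _ _)
  have h3 : 0 ≤ q - min (p : ℝ) q := sub_nonneg.2 (min_le_right _ _)
  have h4 : 0 ≤ 1 - max (p : ℝ) q := sub_nonneg.2 (max_le hp.2 hq.2)
  ext b
  rw [PMF.map_apply, tsum_fintype, Fintype.sum_prod_type]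
  cases b
  · simp only [Fintype.sum_bool, coinPair, coin, PMF.ofFintype_apply, if_true,
      Bool.false_eq_true, if_false, zero_add]
    rw [← ENNReal.ofReal_add h3 h4]
    congr 1
    linarith [min_add_max (p : ℝ) q]
  · simp only [Fintype.sum_bool, coinPair, coin, PMF.ofFintype_apply, if_true,
      Bool.true_eq_false, Bool.false_eq_true, if_false, add_zero]
    rw [← ENNReal.ofReal_add h1 h2]
    congr 1
    ring

lemma coinPair_map_snd (p q : Icc (0 : ℝ) 1) : (coinPair p q).map Prod.snd = coin q := by
  have hp := p.2
  have hq := q.2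
  have h1 : 0 ≤ min (p : ℝ) q := le_min hp.1 hq.1
  have h2 : 0 ≤ p - min (p : ℝ) q := sub_nonneg.2 (min_le_left _ _)
  have h3 : 0 ≤ q - min (p : ℝ) q := sub_nonneg.2 (min_le_right _ _)
  have h4 : 0 ≤ 1 - max (p : ℝ) q := sub_nonneg.2 (max_le hp.2 hq.2)
  ext b
  rw [PMF.map_apply, tsum_fintype, Fintype.sum_prod_type]
  cases b
  · simp only [Fintype.sum_bool, coinPair, coin, PMF.ofFintype_apply, if_true,
      Bool.false_eq_true, if_false, zero_add]
    rw [← ENNReal.ofReal_add h2 h4]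
    congr 1
    linarith [min_add_max (p : ℝ) q]
  · simp only [Fintype.sum_bool, coinPair, coin, PMF.ofFintype_apply, if_true,
      Bool.true_eq_false, Bool.false_eq_true, if_false, add_zero]
    rw [← ENNReal.ofReal_add h1 h3]
    congr 1
    ring

lemma expect_coinPair_mismatch (p q : Icc (0 : ℝ) 1) :
    expect (coinPair p q) (fun z => if z.1 = z.2 then (0 : ℝ) else 1) = |(p : ℝ) - q| := by
  have h2 : 0 ≤ p - min (p : ℝ) q := sub_nonneg.2 (min_le_left _ _)
  have h3 : 0 ≤ q - min (p : ℝ) q := sub_nonneg.2 (min_le_right _ _)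
  rw [expect_eq_sum _ _ (s := Finset.univ) (fun a _ => by simp), Fintype.sum_prod_type]
  simp only [Fintype.sum_bool, coinPair, PMF.ofFintype_apply, if_true, Bool.true_eq_false,
    Bool.false_eq_true, if_false, mul_zero, mul_one, zero_add, add_zero]
  rw [ENNReal.toReal_ofReal h2, ENNReal.toReal_ofReal h3]
  rcases le_total (p : ℝ) q with h | h
  · rw [min_eq_left h, abs_of_nonpos (by linarith)]
    ring
  · rw [min_eq_right h, abs_of_nonneg (by linarith)]
    ring

lemma coinPair_support_finite (p q : Icc (0 : ℝ) 1) : (coinPair p q).support.Finite :=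
  Set.toFinite _

/-- Two trajectories, together with the number of steps at which they moved in different
directions. -/
abbrev CoupledState (m : ℕ) : Type := (Fin (m + 1) → ℤ) × (Fin (m + 1) → ℤ) × ℕ

/-- The target of a rate control step. -/
def move (k : ℤ) (up : Bool) : ℤ := if up then k + 1 else k - 1

/-- One more step of a pair of coupled chains. -/
def CoupledState.step {L T σ : ℝ} (G : Mesh L T σ) {m : ℕ} (s : CoupledState m) (b : Bool × Bool) : CoupledState (m + 1) :=
  (Fin.snoc (α := fun _ => ℤ) s.1 (move (G.reflect (s.1 (Fin.last m))) b.1),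
    Fin.snoc (α := fun _ => ℤ) s.2.1 (move (G.reflect (s.2.1 (Fin.last m))) b.2),
    s.2.2 + if b.1 = b.2 then 0 else 1)

section Coupling

variable {L T : ℝ} (D : Data L) (G : Mesh L T D.σ) (ν ν' : ProbabilityMeasure (PathSpace T L))
  (π π' : RawPolicy)

/-- The up-probability of the first chain in a coupled state. -/
def CoupledState.up₁ {m : ℕ} (s : CoupledState m) : Icc (0 : ℝ) 1 :=
  upProb D G ν (0 + m) (G.reflect (s.1 (Fin.last m))) (π m s.1)

/-- The up-probability of the second chain in a coupled state. -/
def CoupledState.up₂ {m : ℕ} (s : CoupledState m) : Icc (0 : ℝ) 1 :=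
  upProb D G ν' (0 + m) (G.reflect (s.2.1 (Fin.last m))) (π' m s.2.1)

/-- The synchronous coupling of the chains for two flows of measures and two policies. -/
def coupledChain (k : ℤ) : (m : ℕ) → PMF (CoupledState m)
  | 0 => PMF.pure (fun _ => k, fun _ => k, 0)
  | m + 1 => (coupledChain k m).bind fun s =>
      (coinPair (s.up₁ D G ν π) (s.up₂ D G ν' π')).map (s.step G)

lemma coupledChain_support_finite (k : ℤ) (m : ℕ) :
    (coupledChain D G ν ν' π π' k m).support.Finite := by
  induction m with
  | zero => simp [coupledChain]
  | succ m ih =>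
    exact support_bind_finite ih fun s => support_map_finite _ (coinPair_support_finite _ _)

lemma coupledChain_map_fst (k : ℤ) (m : ℕ) :
    (coupledChain D G ν ν' π π' k m).map (fun s => s.1) = chainLaw D G ν π 0 k m := by
  induction m with
  | zero => rw [coupledChain, PMF.pure_map, chainLaw]
  | succ m ih =>
    rw [coupledChain, chainLaw, ← ih, PMF.map_bind, PMF.bind_map]
    congr 1
    funext s
    simp only [Function.comp, rateStep, PMF.map_comp]
    have h := coinPair_map_fst (s.up₁ D G ν π) (s.up₂ D G ν' π')
    unfold CoupledState.up₁ at h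
    rw [← h, PMF.map_comp]
    rfl

lemma coupledChain_map_snd (k : ℤ) (m : ℕ) :
    (coupledChain D G ν ν' π π' k m).map (fun s => s.2.1) = chainLaw D G ν' π' 0 k m := by
  induction m with
  | zero => rw [coupledChain, PMF.pure_map, chainLaw]
  | succ m ih =>
    rw [coupledChain, chainLaw, ← ih, PMF.map_bind, PMF.bind_map]
    congr 1
    funext s
    simp only [Function.comp, rateStep, PMF.map_comp]
    have h := coinPair_map_snd (s.up₁ D G ν π) (s.up₂ D G ν' π')
    unfold CoupledState.up₂ at h
    rw [← h, PMF.map_comp]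
    rfl

variable {D G ν ν' π π'}

lemma coupledChain_last_mem {k : ℤ} (hk : k ∈ Icc (0 : ℤ) G.K) {m : ℕ} {s : CoupledState m}
    (hs : s ∈ (coupledChain D G ν ν' π π' k m).support) :
    G.reflect (s.1 (Fin.last m)) ∈ Icc (0 : ℤ) G.K
      ∧ G.reflect (s.2.1 (Fin.last m)) ∈ Icc (0 : ℤ) G.K := by
  refine ⟨last_mem_of_mem_support_chainLaw D G ν π 0 hk m _ ?_,
    last_mem_of_mem_support_chainLaw D G ν' π' 0 hk m _ ?_⟩
  · rw [← coupledChain_map_fst D G ν ν' π π' k m, PMF.mem_support_map_iff]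
    exact ⟨s, hs, rfl⟩
  · rw [← coupledChain_map_snd D G ν ν' π π' k m, PMF.mem_support_map_iff]
    exact ⟨s, hs, rfl⟩

/-- Reflection acts as the nonexpansive clamp to `[0, K]`, so moves in the same direction do not
separate the chains; opposite moves separate them by at most two. -/
lemma abs_reflect_move_sub_le {x y : ℤ} (hx : x ∈ Icc (0 : ℤ) G.K) (hy : y ∈ Icc (0 : ℤ) G.K)
    (b b' : Bool) : |G.reflect (move x b) - G.reflect (move y b')|
      ≤ |x - y| + 2 * if b = b' then 0 else 1 := by
  rw [mem_Icc] at hx hy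
  have h1 := abs_cases (x - y)
  have h2 := abs_cases (G.reflect (move x b) - G.reflect (move y b'))
  cases b <;> cases b' <;> simp only [move, Mesh.reflect, if_true, Bool.false_eq_true,
    Bool.true_eq_false, if_false] at h2 ⊢ <;> split_ifs at h2 ⊢ <;> omega

/-- The distance of the coupled chains is controlled by the number of mismatched steps. -/
lemma coupledChain_abs_sub_le {k : ℤ} (hk : k ∈ Icc (0 : ℤ) G.K) {m : ℕ} {s : CoupledState m}
    (hs : s ∈ (coupledChain D G ν ν' π π' k m).support) (i : Fin (m + 1)) :
    |G.reflect (s.1 i) - G.reflect (s.2.1 i)| ≤ 2 * (s.2.2 : ℤ) := by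
  induction m with
  | zero =>
    rw [coupledChain, PMF.mem_support_pure_iff] at hs
    subst hs
    simp
  | succ m ih =>
    rw [coupledChain, PMF.mem_support_bind_iff] at hs
    obtain ⟨s', hs', hs⟩ := hs
    rw [PMF.mem_support_map_iff] at hs
    obtain ⟨b, -, rfl⟩ := hs
    have hl := coupledChain_last_mem hk hs'
    refine Fin.lastCases ?_ (fun i => ?_) i
    · simp only [CoupledState.step, Fin.snoc_last]
      refine (abs_reflect_move_sub_le hl.1 hl.2 b.1 b.2).trans ?_
      have := ih hs' (Fin.last m)
      push_cast
      linarith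
    · simp only [CoupledState.step, Fin.snoc_castSucc]
      refine (ih hs' i).trans ?_
      push_cast
      split_ifs <;> omega

/-- The counter never decreases, so its final value bounds the distance at all earlier times. The
uniform metric is thus handled without a maximal inequality. -/
lemma coupledChain_abs_pos_sub_le {k : ℤ} (hk : k ∈ Icc (0 : ℤ) G.K) {m : ℕ} {s : CoupledState m}
    (hs : s ∈ (coupledChain D G ν ν' π π' k m).support) (i : Fin (m + 1)) :
    |G.pos (G.reflect (s.1 i)) - G.pos (G.reflect (s.2.1 i))| ≤ 2 * G.h * s.2.2 := by
  have h : |(G.reflect (s.1 i) : ℝ) - G.reflect (s.2.1 i)| ≤ 2 * s.2.2 := by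
    exact_mod_cast coupledChain_abs_sub_le hk hs i
  unfold Mesh.pos
  rw [← sub_mul, abs_mul, abs_of_pos G.h_pos]
  have := mul_le_mul_of_nonneg_right h G.h_pos.le
  linarith

variable (D G ν ν' π π') in
/-- The expected number of mismatched steps, in units of the largest displacement it causes. -/
def mismatch (k : ℤ) (m : ℕ) : ℝ :=
  expect (coupledChain D G ν ν' π π' k m) fun s => 2 * G.h * s.2.2

lemma mismatch_zero (k : ℤ) : mismatch D G ν ν' π π' k 0 = 0 := by
  rw [mismatch, coupledChain, expect_pure]
  simp

lemma mismatch_succ (k : ℤ) (m : ℕ) : mismatch D G ν ν' π π' k (m + 1)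
    = expect (coupledChain D G ν ν' π π' k m) fun s =>
      2 * G.h * s.2.2 + 2 * G.h * |(s.up₁ D G ν π : ℝ) - s.up₂ D G ν' π'| := by
  rw [mismatch, coupledChain, expect_bind (coupledChain_support_finite _ _ _ _ _ _ _ _)
    fun s => support_map_finite _ (coinPair_support_finite _ _)]
  congr 1
  funext s
  rw [expect_map (coinPair_support_finite _ _), ← expect_coinPair_mismatch]
  have h := expect_affine (coinPair_support_finite (s.up₁ D G ν π) (s.up₂ D G ν' π'))
    (fun z => if z.1 = z.2 then (0 : ℝ) else 1) (2 * G.h) (2 * G.h * s.2.2)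
  rw [add_comm (2 * G.h * (s.2.2 : ℝ)), ← h]
  congr 1
  funext z
  simp only [Function.comp, CoupledState.step]
  push_cast
  ring

/-- The conditional probability of a new mismatch is affine in the counter, so the recursion closes
in expectation. -/
lemma mismatch_succ_le {k : ℤ} {m : ℕ} {κ w : ℝ}
    (h : ∀ s ∈ (coupledChain D G ν ν' π π' k m).support,
      2 * G.h * |(s.up₁ D G ν π : ℝ) - s.up₂ D G ν' π'| ≤ κ * (w + 2 * G.h * s.2.2)) :
    mismatch D G ν ν' π π' k (m + 1)
      ≤ mismatch D G ν ν' π π' k m + κ * (w + mismatch D G ν ν' π π' k m) := by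
  have hfin := coupledChain_support_finite D G ν ν' π π' k m
  rw [mismatch_succ]
  refine (expect_mono hfin (c' := fun s => (1 + κ) * (2 * G.h * s.2.2) + κ * w)
    fun s hs => ?_).trans (le_of_eq ?_)
  · have := h s hs
    linarith
  · rw [expect_affine hfin, mismatch]
    ring

/-- As long as `ρ ≤ w / 2`, each increment is at most `3 / 2 * w * κ m`; a total weight of `1 / 3`
reproduces the bound `w / 2`. -/
lemma gronwall_sum {ρ κ : ℕ → ℝ} {w : ℝ} {N : ℕ} (hw : 0 ≤ w) (h0 : ρ 0 = 0)
    (hκ : ∀ m < N, 0 ≤ κ m) (h : ∀ m < N, ρ (m + 1) ≤ ρ m + κ m * (w + ρ m))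
    (hsum : ∑ m ∈ Finset.range N, κ m ≤ 1 / 3) : ρ N ≤ w / 2 := by
  have key : ∀ m ≤ N, ρ m ≤ 3 / 2 * w * ∑ i ∈ Finset.range m, κ i := by
    intro m
    induction m with
    | zero => simp [h0]
    | succ m ih =>
      intro hm
      have h1 := ih (by omega)
      have h2 : ∑ i ∈ Finset.range m, κ i ≤ ∑ i ∈ Finset.range N, κ i :=
        Finset.sum_le_sum_of_subset_of_nonneg (by simpa using (by omega : m ≤ N))
          fun i hi _ => hκ i (Finset.mem_range.1 hi)
      have h3 : 3 / 2 * w * ∑ i ∈ Finset.range m, κ i ≤ 3 / 2 * w * (1 / 3) :=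
        mul_le_mul_of_nonneg_left (h2.trans hsum) (by positivity)
      have h4 := h m (by omega)
      have h5 : κ m * (w + ρ m) ≤ κ m * (3 / 2 * w) :=
        mul_le_mul_of_nonneg_left (by linarith) (hκ m (by omega))
      rw [Finset.sum_range_succ]
      linarith
  have h1 := key N le_rfl
  have h2 : 3 / 2 * w * ∑ i ∈ Finset.range N, κ i ≤ 3 / 2 * w * (1 / 3) :=
    mul_le_mul_of_nonneg_left hsum (by positivity)
  linarith

/-- Abel summation: rewritten in terms of the values `d i`, the expression has nonnegative weights
`b - a 0`, `a 0 - a 1`, and so on, with total `b`. -/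
lemma abs_abel_sum_le {n : ℕ} (d : Fin (n + 1) → ℝ) (a : Fin n → ℝ) {M b : ℝ}
    (hd : ∀ i, |d i| ≤ M) (ha : Antitone a) (ha0 : ∀ i, 0 ≤ a i) (hab : ∀ i, a i ≤ b)
    (hb : 0 ≤ b) : |b * d 0 + ∑ j : Fin n, (d j.succ - d j.castSucc) * a j| ≤ b * M := by
  induction n generalizing b with
  | zero =>
    simp only [Finset.univ_eq_empty, Finset.sum_empty, add_zero]
    rw [abs_mul, abs_of_nonneg hb]
    exact mul_le_mul_of_nonneg_left (hd 0) hb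
  | succ n ih =>
    have h := ih (fun i => d i.succ) (fun i => a i.succ) (fun i => hd _)
      (fun i j hij => ha (Fin.succ_le_succ_iff.2 hij)) (fun i => ha0 _) (b := a 0)
      (fun i => ha (Fin.zero_le _)) (ha0 0)
    rw [Fin.sum_univ_succ]
    have e : b * d 0 + ((d (Fin.succ 0) - d (Fin.castSucc 0)) * a 0
        + ∑ i : Fin n, (d i.succ.succ - d i.succ.castSucc) * a i.succ)
        = (b - a 0) * d 0 + (a 0 * d (Fin.succ 0)
          + ∑ i : Fin n, (d i.succ.succ - d i.castSucc.succ) * a i.succ) := by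
      simp only [Fin.castSucc_zero, Fin.castSucc_succ]
      ring
    rw [e]
    refine (abs_add_le _ _).trans ?_
    have h1 : |(b - a 0) * d 0| ≤ (b - a 0) * M := by
      rw [abs_mul, abs_of_nonneg (sub_nonneg.2 (hab 0))]
      exact mul_le_mul_of_nonneg_left (hd 0) (sub_nonneg.2 (hab 0))
    linarith

/-- At a fixed time the fraction of step `j` already run decreases in `j`, so Abel summation with `b
= 1` applies; the projection is nonexpansive. -/
lemma dist_interpolate_le {X X' : Fin (G.N + 1) → ℤ} {M : ℝ}
    (hM : ∀ i, |G.pos (X i) - G.pos (X' i)| ≤ M) :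
    dist (G.interpolate X) (G.interpolate X') ≤ M := by
  have hM0 : 0 ≤ M := (abs_nonneg _).trans (hM 0)
  rw [ContinuousMap.dist_le hM0]
  intro t
  rw [Subtype.dist_eq, Real.dist_eq]
  refine (abs_projIcc_sub_projIcc (h := G.L_nonneg)).trans ?_
  have h := abs_abel_sum_le (fun i => G.pos (X i) - G.pos (X' i))
    (fun j : Fin G.N => max 0 (min 1 ((t : ℝ) / G.Δ - (j : ℕ)))) hM
    (fun i j hij => by
      have : ((i : ℕ) : ℝ) ≤ (j : ℕ) := by exact_mod_cast hij
      exact max_le_max le_rfl (min_le_min le_rfl (by linarith)))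
    (fun i => le_max_left _ _) (b := 1)
    (fun i => max_le zero_le_one (min_le_left _ _)) zero_le_one
  rw [one_mul, one_mul] at h
  refine le_trans (le_of_eq ?_) h
  congr 1
  rw [add_sub_add_comm, ← Finset.sum_sub_distrib]
  congr 1
  refine Finset.sum_congr rfl fun j _ => ?_
  ring

/-- The Wasserstein distance of the marginals of a discrete law on pairs. -/
lemma W₁_le_expect {S : Type*} [MeasurableSpace S] [MetricSpace S] [BorelSpace S]
    [SecondCountableTopology S] {C : ℝ} (hC : ∀ x y : S, dist x y ≤ C) (Q : PMF (S × S))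
    {μ μ' : ProbabilityMeasure S} (hμ : (μ : Measure S) = (Q.map Prod.fst).toMeasure)
    (hμ' : (μ' : Measure S) = (Q.map Prod.snd).toMeasure) :
    W₁ μ μ' ≤ expect Q fun z => dist z.1 z.2 := by
  let Γ : ProbabilityMeasure (S × S) := ⟨Q.toMeasure, inferInstance⟩
  have h1 : Γ.map measurable_fst.aemeasurable = μ := by
    apply Subtype.ext
    exact (PMF.toMeasure_map _ Q measurable_fst).trans hμ.symm
  have h2 : Γ.map measurable_snd.aemeasurable = μ' := by
    apply Subtype.ext
    exact (PMF.toMeasure_map _ Q measurable_snd).trans hμ'.symm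
  refine (W₁_le_integral Γ h1 h2).trans (le_of_eq ?_)
  exact PMF.integral_eq_tsum Q _ (integrable_dist_of_le hC Γ)

/-- Any two laws of interpolated chains are compared through the synchronous coupling. -/
lemma W₁_interpolate_le_mismatch {k : ℤ} (hk : k ∈ Icc (0 : ℤ) G.K)
    {μ μ' : ProbabilityMeasure (PathSpace T L)}
    (hμ : (μ : Measure (PathSpace T L)) = ((chainLaw D G ν π 0 k G.N).map
      (fun Z => G.interpolate (fun j => G.reflect (Z j)))).toMeasure)
    (hμ' : (μ' : Measure (PathSpace T L)) = ((chainLaw D G ν' π' 0 k G.N).map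
      (fun Z => G.interpolate (fun j => G.reflect (Z j)))).toMeasure) :
    W₁ μ μ' ≤ mismatch D G ν ν' π π' k G.N := by
  have hfin := coupledChain_support_finite D G ν ν' π π' k G.N
  refine (W₁_le_expect (dist_pathSpace_le G.L_nonneg)
    ((coupledChain D G ν ν' π π' k G.N).map fun s =>
      (G.interpolate fun j => G.reflect (s.1 j), G.interpolate fun j => G.reflect (s.2.1 j)))
    (hμ.trans ?_) (hμ'.trans ?_)).trans ?_
  · congr 1
    rw [← coupledChain_map_fst D G ν ν' π π' k G.N, PMF.map_comp, PMF.map_comp]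
    simp only [Function.comp_def]
  · congr 1
    rw [← coupledChain_map_snd D G ν ν' π π' k G.N, PMF.map_comp, PMF.map_comp]
    simp only [Function.comp_def]
  · rw [expect_map hfin, mismatch]
    refine expect_mono hfin fun s hs => ?_
    have h := dist_interpolate_le (G := G) (X := fun j => G.reflect (s.1 j))
      (X' := fun j => G.reflect (s.2.1 j)) (coupledChain_abs_pos_sub_le hk hs)
    exact h

end Coupling

/-! ### The contraction estimate. -/

section Contraction

variable {L T : ℝ} {D : Data L} {G : Mesh L T D.σ} {ν ν' : ProbabilityMeasure (PathSpace T L)}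
  {αhat : ℝ → ProbabilityMeasure (Icc (0 : ℝ) L) → ℝ → ℝ → ℝ} {T₀ c cB cR ca : ℝ}

/-- The constant in the dependence of the optimally controlled drift on the flow and the
position. -/
def driftConst (L σ T₀ c cB cR ca : ℝ) : ℝ :=
  c * (1 + ca) * (σ * √T₀)
    + c * ca * (gradSpaceConst L σ T₀ c cB cR + gradMeasureConst T₀ c cR)

lemma driftConst_nonneg (hreg : D.Regular T₀ c cB cR) (hL : 0 < L) (hσ : 0 < D.σ)
    (hT₀ : 0 ≤ T₀) (hca : 0 ≤ ca) : 0 ≤ driftConst L D.σ T₀ c cB cR ca := by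
  have hc := hreg.c_nonneg
  have h1 := gradMeasureConst_nonneg hreg hT₀
  have h2 := gradSpaceConst_nonneg hreg hL hσ hT₀
  unfold driftConst
  positivity

/-- The clamp is nonexpansive, so no bound on the drift is needed here; the prefactor is `2h · h /
(2σ²) = Δ`. -/
lemma two_h_mul_abs_upProb_sub_le (j : ℕ) (k k' : ℤ) (u u' : ℝ) :
    2 * G.h * |(upProb D G ν j k u : ℝ) - upProb D G ν' j k' u'|
      ≤ G.Δ * |D.b (G.time j) (flow D G ν j) (G.pos k) u
        - D.b (G.time j) (flow D G ν' j) (G.pos k') u'| := by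
  have hh0 := G.h_pos
  have h1 : |(upProb D G ν j k u : ℝ) - upProb D G ν' j k' u'| ≤ _ :=
    abs_projIcc_sub_projIcc (h := zero_le_one)
  refine (mul_le_mul_of_nonneg_left h1 (by positivity)).trans (le_of_eq ?_)
  rw [← sub_div, add_sub_add_right_eq_sub, ← mul_sub, abs_div, abs_mul, abs_of_pos hh0,
    abs_of_nonneg (show 0 ≤ 2 * D.σ ^ 2 by positivity)]
  unfold Mesh.Δ
  rcases eq_or_ne D.σ 0 with h | h
  · simp [h]
  · field_simp

/-- Dependence of the optimally controlled drift on the flow and the position. -/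
lemma Δ_mul_abs_drift_sub_le (hreg : D.Regular T₀ c cB cR) (hL : 0 < L) (hσ : 0 < D.σ)
    (hT : 0 < T) (hT₀ : T ≤ T₀) (hh : G.h * cB ≤ D.σ ^ 2) (hmin : D.IsUniqueMinimizer T₀ αhat)
    (hca : 0 ≤ ca)
    (hα : ∀ t ∈ Icc 0 T₀, ∀ η η' : ProbabilityMeasure (Icc (0 : ℝ) L),
      ∀ x ∈ Icc 0 L, ∀ x' ∈ Icc 0 L, ∀ p p' : ℝ,
        |αhat t η x p - αhat t η' x' p'| ≤ ca * (W₁ η η' + |x - x'| + |p - p'|))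
    (hsmall : 16 * (G.Δ * cB / (2 * G.h)) * √(G.N + 1) ≤ 1) {w : ℝ}
    (hw : ∀ j, W₁ (flow D G ν j) (flow D G ν' j) ≤ w)
    (hw' : ∀ j, W₁ (flow D G ν' j) (flow D G ν j) ≤ w) {j : ℕ} (hj : j < G.N) {k k' : ℤ}
    (hk : k ∈ Icc (0 : ℤ) G.K) (hk' : k' ∈ Icc (0 : ℤ) G.K) :
    G.Δ * |D.b (G.time j) (flow D G ν j) (G.pos k)
          (αhat (G.time j) (flow D G ν j) (G.pos k) (gradV D G ν j k))
        - D.b (G.time j) (flow D G ν' j) (G.pos k')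
          (αhat (G.time j) (flow D G ν' j) (G.pos k') (gradV D G ν' j k'))|
      ≤ driftConst L D.σ T₀ c cB cR ca * (G.Δ / (G.h * √((G.N : ℝ) - j)))
        * (w + |G.pos k - G.pos k'|) := by
  have hs := sqrt_steps_pos hj
  have hh0 := G.h_pos
  have hc := hreg.c_nonneg
  have hw0 : 0 ≤ w := (W₁_nonneg _ _).trans (hw 0)
  have ht := G.time_mem hT₀ hj.le
  have hx := G.pos_mem hk
  have hx' := G.pos_mem hk'
  have hb := hreg.b_lip _ ht (flow D G ν j) (flow D G ν' j) _ hx _ hx' _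
    (hmin _ ht (flow D G ν j) _ hx (gradV D G ν j k)).1 _
    (hmin _ ht (flow D G ν' j) _ hx' (gradV D G ν' j k')).1
  have ha := hα _ ht (flow D G ν j) (flow D G ν' j) _ hx _ hx' (gradV D G ν j k)
    (gradV D G ν' j k')
  have hg := abs_gradV_sub_le hreg hL hσ hT hT₀ hh hmin hsmall hw hw' hj hk hk'
  have hW := hw j
  have hstep := h_mul_sqrt_steps_le (G := G) hσ hT₀ j
  set d := |G.pos k - G.pos k'|
  set A := gradSpaceConst L D.σ T₀ c cB cR + gradMeasureConst T₀ c cR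
  set hs' := G.h * √((G.N : ℝ) - j)
  have hs0 : 0 < hs' := by positivity
  have hd : 0 ≤ d := abs_nonneg _
  have h1 : ca * (W₁ (flow D G ν j) (flow D G ν' j) + d
      + |gradV D G ν j k - gradV D G ν' j k'|) ≤ ca * (w + d + A * (w + d) / hs') :=
    mul_le_mul_of_nonneg_left (by linarith) hca
  have h2 := mul_le_mul_of_nonneg_left (show W₁ (flow D G ν j) (flow D G ν' j) + d
      + |αhat (G.time j) (flow D G ν j) (G.pos k) (gradV D G ν j k)
        - αhat (G.time j) (flow D G ν' j) (G.pos k') (gradV D G ν' j k')|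
      ≤ w + d + ca * (w + d + A * (w + d) / hs') by linarith) hc
  refine (mul_le_mul_of_nonneg_left (hb.trans h2) G.Δ_nonneg).trans ?_
  -- The gradient parts match exactly. The nonsingular part `c (1 + ca)` has been enlarged by `σ √T₀
  -- / hs'`, which is at least one by `hstep`.
  have e : driftConst L D.σ T₀ c cB cR ca * (G.Δ / hs') * (w + d)
      - G.Δ * (c * (w + d + ca * (w + d + A * (w + d) / hs')))
      = G.Δ / hs' * (c * (1 + ca) * (w + d)) * (D.σ * √T₀ - hs') := by
    unfold driftConst
    field_simp
    ring
  rw [← sub_nonneg, e]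
  exact mul_nonneg (mul_nonneg (div_nonneg G.Δ_nonneg hs0.le) (by positivity))
    (sub_nonneg.2 hstep)

/-- A Riemann sum for `σ⁻¹ ∫₀ᵀ (T - t)^(-1/2) dt`. The integrability of this singularity yields the
small factor `√T`. -/
lemma sum_step_weights_le (hσ : 0 < D.σ) :
    ∑ m ∈ Finset.range G.N, G.Δ / (G.h * √((G.N : ℝ) - m)) ≤ 2 * √T / D.σ := by
  have hh0 := G.h_pos
  have h1 : ∑ m ∈ Finset.range G.N, G.Δ / (G.h * √((G.N : ℝ) - m))
      = G.Δ / G.h * ∑ m ∈ Finset.range G.N, 1 / √((G.N : ℝ) - m) := by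
    rw [Finset.mul_sum]
    refine Finset.sum_congr rfl fun m _ => ?_
    rw [div_mul_div_comm, mul_one]
  rw [h1]
  refine (mul_le_mul_of_nonneg_left (sum_inv_sqrt_sub_le G.N)
    (div_nonneg G.Δ_nonneg hh0.le)).trans (le_of_eq ?_)
  have h2 : √T = G.h * √G.N / D.σ := by
    rw [h_mul_sqrt_N hσ]
    field_simp
  rw [h2]
  unfold Mesh.Δ
  field_simp

lemma drift_smallness (hcB : 0 ≤ cB) (hσ : 0 < D.σ) (hT : 0 < T) (h : 16 * cB * √T ≤ D.σ) :
    16 * (G.Δ * cB / (2 * G.h)) * √(G.N + 1) ≤ 1 := by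
  have hh0 := G.h_pos
  have h1 : √((G.N : ℝ) + 1) ≤ 2 * √G.N := by
    have hN : (1 : ℝ) ≤ G.N := by exact_mod_cast one_le_N hT
    refine Real.sqrt_le_iff.2 ⟨by positivity, ?_⟩
    rw [mul_pow, Real.sq_sqrt (by linarith)]
    linarith
  have h2 := h_mul_sqrt_N (G := G) hσ
  have e : 16 * (G.Δ * cB / (2 * G.h)) * (2 * √G.N)
      = 16 * cB * (G.h * √G.N) / D.σ ^ 2 := by
    unfold Mesh.Δ
    field_simp
  refine (mul_le_mul_of_nonneg_left h1 ?_).trans ?_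
  · have := G.Δ_nonneg
    positivity
  · rw [e, h2, div_le_one (by positivity)]
    nlinarith

/-- The map `Φ` is a contraction for small times. -/
lemma W₁_Φ_le (hreg : D.Regular T₀ c cB cR) (hL : 0 < L) (hσ : 0 < D.σ)
    (hT : 0 < T) (hT₀ : T ≤ T₀) (hh : G.h * cB ≤ D.σ ^ 2) (hmin : D.IsUniqueMinimizer T₀ αhat)
    (hca : 0 ≤ ca)
    (hα : ∀ t ∈ Icc 0 T₀, ∀ η η' : ProbabilityMeasure (Icc (0 : ℝ) L),
      ∀ x ∈ Icc 0 L, ∀ x' ∈ Icc 0 L, ∀ p p' : ℝ,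
        |αhat t η x p - αhat t η' x' p'| ≤ ca * (W₁ η η' + |x - x'| + |p - p'|))
    (hT₁ : 16 * cB * √T ≤ D.σ) (hT₂ : 6 * driftConst L D.σ T₀ c cB cR ca * √T ≤ D.σ)
    (hsymm : W₁ ν' ν ≤ W₁ ν ν') {x₀ : ℝ} (hx₀ : x₀ ∈ Icc 0 L) :
    W₁ (Φ D G ν αhat x₀) (Φ D G ν' αhat x₀) ≤ W₁ ν ν' / 2 := by
  have hh0 := G.h_pos
  have hk : ⌊x₀ / G.h⌋ ∈ Icc (0 : ℤ) G.K := by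
    refine ⟨Int.floor_nonneg.2 (div_nonneg hx₀.1 hh0.le), ?_⟩
    have h1 : x₀ / G.h ≤ G.K := by
      rw [div_le_iff₀ hh0, G.K_mul_h]
      exact hx₀.2
    exact_mod_cast (Int.floor_le _).trans h1
  have hC := driftConst_nonneg (ca := ca) hreg hL hσ (hT.le.trans hT₀) hca
  set C := driftConst L D.σ T₀ c cB cR ca
  have hw : ∀ j, W₁ (flow D G ν j) (flow D G ν' j) ≤ W₁ ν ν' :=
    fun j => W₁_marginal_le hL.le G.T_nonneg ν ν' _
  have hw' : ∀ j, W₁ (flow D G ν' j) (flow D G ν j) ≤ W₁ ν ν' :=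
    fun j => (W₁_marginal_le hL.le G.T_nonneg ν' ν _).trans hsymm
  have hsmall := drift_smallness (G := G) hreg.cB_nonneg hσ hT hT₁
  refine (W₁_interpolate_le_mismatch (ν := ν) (ν' := ν') (π := optimalPolicy D G ν αhat)
    (π' := optimalPolicy D G ν' αhat) hk rfl rfl).trans ?_
  refine gronwall_sum (ρ := mismatch D G ν ν' (optimalPolicy D G ν αhat)
    (optimalPolicy D G ν' αhat) ⌊x₀ / G.h⌋)
    (κ := fun m => C * (G.Δ / (G.h * √((G.N : ℝ) - m)))) (W₁_nonneg _ _) (mismatch_zero _)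
    (fun m _ => ?_) (fun m hm => ?_) ?_
  · have := G.Δ_nonneg
    positivity
  · refine mismatch_succ_le fun s hs => ?_
    have hl := coupledChain_last_mem hk hs
    have hd := coupledChain_abs_pos_sub_le hk hs (Fin.last m)
    unfold CoupledState.up₁ CoupledState.up₂
    rw [zero_add]
    refine (two_h_mul_abs_upProb_sub_le _ _ _ _ _).trans ?_
    refine (Δ_mul_abs_drift_sub_le hreg hL hσ hT hT₀ hh hmin hca hα hsmall hw hw' hm hl.1
      hl.2).trans ?_
    refine mul_le_mul_of_nonneg_left (by linarith) ?_
    have := G.Δ_nonneg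
    positivity
  -- The total weight is at most `2 C √T / σ`; the factor `6` in `hT₂` makes this `1 / 3`.
  · rw [← Finset.mul_sum]
    refine (mul_le_mul_of_nonneg_left (sum_step_weights_le hσ) hC).trans ?_
    rw [← mul_div_assoc, div_le_iff₀ hσ]
    linarith

end Contraction

/-- Swapping the coordinates of a coupling. It is needed because the two-sided Hamiltonian estimate
compares the flows in both orders. -/
lemma W₁_symm_le {S : Type*} [MeasurableSpace S] [MetricSpace S] [BorelSpace S]
    [SecondCountableTopology S] (μ ν : ProbabilityMeasure S) : W₁ ν μ ≤ W₁ μ ν := by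
  refine le_csInf (couplingCosts_nonempty μ ν) ?_
  rintro c ⟨π, h1, h2, rfl⟩
  refine (W₁_le_integral (π.map (f := Prod.swap) measurable_swap.aemeasurable) ?_ ?_).trans
    (le_of_eq ?_)
  · rw [← h2]
    apply Subtype.ext
    exact Measure.map_map measurable_fst measurable_swap
  · rw [← h1]
    apply Subtype.ext
    exact Measure.map_map measurable_snd measurable_swap
  · rw [ProbabilityMeasure.toMeasure_map, integral_map measurable_swap.aemeasurable
      (measurable_fst.dist measurable_snd).aestronglyMeasurable]
    simp only [Prod.fst_swap, Prod.snd_swap, dist_comm]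

end ReflectedMFG

end

theorem proposition3p2 (L T₀ : ℝ) (hL : 0 < L) (hT₀ : 0 < T₀) (D : ReflectedMFG.Data L)
    (hσ : 0 < D.σ) (hU : IsCompact D.U) (hD : D.IsLipschitz T₀)
    (αhat : ℝ → MeasureTheory.ProbabilityMeasure (Set.Icc (0 : ℝ) L) → ℝ → ℝ → ℝ)
    (hmin : D.IsUniqueMinimizer T₀ αhat) (hα : ReflectedMFG.IsLipschitzSelector T₀ αhat) :
    ∃ That hhat q : ℝ, 0 < That ∧ That ≤ T₀ ∧ 0 < hhat ∧ 0 < q ∧ q < 1 ∧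
      (∀ t ∈ Set.Icc 0 T₀, ∀ η : MeasureTheory.ProbabilityMeasure (Set.Icc (0 : ℝ) L),
        ∀ x ∈ Set.Icc 0 L, ∀ u ∈ D.U, hhat * |D.b t η x u| ≤ D.σ ^ 2) ∧
      ∀ T : ℝ, 0 < T → T ≤ That → ∀ x₀ ∈ Set.Icc 0 L, ∀ G : ReflectedMFG.Mesh L T D.σ,
        G.h < min hhat That →
        ∀ ν ν' : MeasureTheory.ProbabilityMeasure (ReflectedMFG.PathSpace T L),
          ReflectedMFG.W₁ (ReflectedMFG.Φ D G ν αhat x₀) (ReflectedMFG.Φ D G ν' αhat x₀) ^ 2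
            ≤ q * (G.h ^ 2 + ReflectedMFG.W₁ ν ν' ^ 2) := by
  have hne : D.U.Nonempty := ⟨_, (hmin 0 ⟨le_rfl, hT₀.le⟩
    ⟨MeasureTheory.Measure.dirac ⟨0, le_rfl, hL.le⟩, inferInstance⟩ 0 ⟨le_rfl, hL.le⟩ 0).1⟩
  obtain ⟨c, cB, cR, hreg⟩ := hD.exists_regular hL hT₀ hU hne
  obtain ⟨ca, hca, hα⟩ := hα
  have hcB := hreg.cB_nonneg
  have hC := ReflectedMFG.driftConst_nonneg (ca := ca) hreg hL hσ hT₀.le hca.le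
  set C := ReflectedMFG.driftConst L D.σ T₀ c cB cR ca with hCdef
  -- For `T ≤ s ^ 2` both smallness conditions of `W₁_Φ_le` hold at once; the summand `1` keeps the
  -- denominator positive when `C` and `cB` vanish.
  set s : ℝ := D.σ / (6 * C + 16 * cB + 1)
  have hden : 0 < 6 * C + 16 * cB + 1 := by positivity
  have hs : 0 < s := div_pos hσ hden
  have hs' : (6 * C + 16 * cB + 1) * s = D.σ := mul_div_cancel₀ _ hden.ne'
  have hhhat : D.σ ^ 2 / (cB + 1) * cB ≤ D.σ ^ 2 := by
    rw [div_mul_eq_mul_div, div_le_iff₀ (by positivity)]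
    nlinarith [sq_nonneg D.σ]
  -- The value `1 / 4` is the square of the contraction factor `1 / 2`.
  refine ⟨min T₀ (s ^ 2), D.σ ^ 2 / (cB + 1), 1 / 4, lt_min hT₀ (by positivity), min_le_left _ _,
    by positivity, by norm_num, by norm_num, ?_, ?_⟩
  · intro t ht η x hx u hu
    exact (mul_le_mul_of_nonneg_left (hreg.b_bound t ht η x hx u hu) (by positivity)).trans hhhat
  · intro T hT hThat x₀ hx₀ G hG ν ν'
    have hsT : √T ≤ s := Real.sqrt_le_iff.2 ⟨hs.le, hThat.trans (min_le_right _ _)⟩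
    have hsT0 : 0 ≤ √T := Real.sqrt_nonneg T
    have hh : G.h * cB ≤ D.σ ^ 2 :=
      (mul_le_mul_of_nonneg_right (hG.le.trans (min_le_left _ _)) hcB).trans hhhat
    have h1 : 16 * cB * √T ≤ D.σ := by
      have := mul_le_mul_of_nonneg_left hsT (show 0 ≤ 16 * cB by positivity)
      nlinarith
    have h2 : 6 * C * √T ≤ D.σ := by
      have := mul_le_mul_of_nonneg_left hsT (show 0 ≤ 6 * C by positivity)
      nlinarith
    have h := ReflectedMFG.W₁_Φ_le (ν := ν) (ν' := ν') hreg hL hσ hT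
      (hThat.trans (min_le_left _ _)) hh hmin hca.le hα h1 h2
      (ReflectedMFG.W₁_symm_le ν ν') hx₀
    have h0 := ReflectedMFG.W₁_nonneg (ReflectedMFG.Φ D G ν αhat x₀)
      (ReflectedMFG.Φ D G ν' αhat x₀)
    have h3 := pow_le_pow_left₀ h0 h 2
    nlinarith [sq_nonneg G.h]
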